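/- Let $M=\mathbb R^4$ be Minkowski space with metric $\eta=\mathrm{diag}(1,-1,-1,-1)$, $a\cdot b=\eta_{\alpha\beta}a^\alpha b^\beta$, $(a\wedge b)\cdot(c\wedge d)=(a\cdot c)(b\cdot d)-(a\cdot d)(b\cdot c)$. For a vector or bivector $a$ write $\|a\|^2=a\cdot a$ (a signed quantity), $\|a\|=|a\cdot a|^{1/2}$, $\|a\|^{2k+1}=(a\cdot a)^k\,\|a\|$, and $\|a\|^{4/3}=|a\cdot a|^{2/3}$. Let $\varepsilon_{0123}=1$, $(\ast\,a\wedge b\wedge c)_\delta=\varepsilon_{\alpha\beta\gamma\delta}a^\alpha b^\beta c^\gamma$ and $\ast\,a\wedge b\wedge c\wedge d=\varepsilon_{\alpha\beta\gamma\delta}a^\alpha b^\beta c^\gamma d^\delta$. Fix $m\in\mathbb R$ and a constant spacelike vector $s$ ($s\cdot s<0$). All curves $c$ are $C^3$ on an open interval $I$, with timelike velocity $u=\dot c$ ($u\cdot u>0$); dots are derivatives in the parameter $\tau$. Consider the parameter-invariant third-order equation $$\mathcal E:=\frac{\ast\,\ddot u\wedge u\wedge s}{\|s\wedge u\|^3}-3\,\frac{(\dot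 u\wedge s)\cdot(u\wedge s)}{\|s\wedge u\|^5}\ast\dot u\wedge u\wedge s+\frac m{\|s\|^3}\Big[\frac{\dot u}{\|u\|}-\frac{\dot u\cdot u}{\|u\|^3}u\Big]=0,\tag{1}$$ the constraint $s\cdot u=0$, and, for a vector $e$, the second-order Lagrange function $$\mathcal L_e=\frac{\ast\,\dot u\wedge u\wedge s\wedge e}{\|s\|^2\|s\wedge u\|}\cdot\frac{\|s\|^2(u\cdot e)-(s\cdot u)(s\cdot e)}{\|(u\cdot e)s-(s\cdot e)u\|^2-\|e\|^2\|s\wedge u\|^2}-\frac m{\|s\|^3}\|u\|,$$ regular at the points where $u,s,e$ are linearly independent. On the space of $(x,u,\dot u)$ let $\zeta^1=u\,\partial_u+2\dot u\,\partial_{\dot u}$, $\zeta^2=u\,\partial_{\dot u}$ be the Liouville fields. We say that an equation $\ddot u=\xi(\dot u,u)$ is the equation of the autoparallel curves of a second-order connection, with multipliers $\kappa,\mu$, if the vector field $\boldsymbol\xi=u\,\partial_x+\dot u\,\partial_u+\xi\,\partial_{\dot u}$ is differentiable and $[\zeta^1,\boldsymbol\xi]=\boldsymbol\xi-3\mu\zeta^2$,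 $[\zeta^2,\boldsymbol\xi]=\zeta^1-3\kappa\zeta^2$ at all $(x,u,\dot u)$ with $u\cdot u>0$. Then: 1. For every basis $(e_{(\alpha)})$ of $M$ and every $\alpha$, the Euler–Lagrange expression of $\mathcal L_{e_{(\alpha)}}$ along a curve equals $\mathcal E$ wherever $\mathcal L_{e_{(\alpha)}}$ is regular. 2. Along curves with $s\cdot u=0$, equation (1) is equivalent to Mathisson's equation of the free relativistic top $$\varepsilon_{\alpha\beta\gamma\delta}\ddot u^\beta u^\gamma s^\delta-3\frac{\dot u\cdot u}{\|u\|^2}\varepsilon_{\alpha\beta\gamma\delta}\dot u^\beta u^\gamma s^\delta-m\big(\|u\|^2\dot u_\alpha-(\dot u\cdot u)u_\alpha\big)=0 .$$ 3. For every function $\Psi(\dot u,u)$ and every curve with $s\cdot u=0$, equation (1) together with the parametrization condition $\ddot u\cdot u=\|u\|^2\Psi(\dot u,u)$ is equivalent to $$\ddot u=3\frac{\dot u\cdot u}{\|u\|^2}\dot u-3\frac{(\dot u\cdot u)^2}{\|u\|^4}u-m\frac{\|u\wedge s\|}{\|s\|^3\|u\|}\ast\dot u\wedge u\wedge s+\Psi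 u.\tag{2}$$ 4. For $\Psi=\frac3{\|u\|^2}\big(\tfrac12\|\dot u\|^2+f(\|\dot u\wedge u\|)\big)$ with a function $f$, equation (2) is the equation of the autoparallel curves of a second-order connection with $\kappa=\mu=0$ if and only if $f(r)=A\,r^{4/3}$ for all $r\ge0$, for some constant $A\in\mathbb R$. 5. For every $A\in\mathbb R$, the equation $$\ddot u=3\frac{\dot u\cdot u}{\|u\|^2}\dot u-3\Big[\frac{(\dot u\cdot u)^2}{\|u\|^4}-\frac12\frac{\|\dot u\|^2}{\|u\|^2}-A\frac{\|\dot u\wedge u\|^{4/3}}{\|u\|^2}\Big]u-m\frac{\|u\wedge s\|}{\|s\|^3\|u\|}\ast\dot u\wedge u\wedge s\tag{3}$$ is the equation of the autoparallel curves of a second-order connection with $\kappa=\mu=0$. Along curves with $s\cdot u=0$ it is equivalent to (1) together with the parametrization condition $\ddot u\cdot u=3\big(\tfrac12\|\dot u\|^2+A\|\dot u\wedge u\|^{4/3}\big)$. 6. For every $A\in\mathbb R$, the world lines of (3) are exactly the extremals of the Lagrange functions $\mathcal L_{e_{(\alpha)}}$ that satisfy $s\cdot u=0$. Precisely: call a curve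 a world line if near each of its points some reparametrization $c\circ\varphi$ ($\varphi$ of class $C^3$, $\varphi'\ne0$) solves (3) and satisfies the constraint. For every basis $(e_{(\alpha)})$, a curve along which $\mathcal L_{e_{(\alpha)}}$ is regular is a world line if and only if it satisfies $s\cdot u=0$ and the Euler–Lagrange equation of $\mathcal L_{e_{(\alpha)}}$; and an arbitrary curve is a world line if and only if it satisfies $s\cdot u=0$ and at each of its points the Euler–Lagrange equation of some $\mathcal L_{e_{(\alpha)}}$ that is regular there. -/

import Mathlib

noncomputable section

namespace RelTop

/-- Four-dimensional pseudo-Euclidean (Minkowski) space, in Cartesian coordinates `x⁰, …, x³`. -/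
abbrev E : Type := Fin 4 → ℝ

/-- The canonical diagonal metric `η = diag (1, -1, -1, -1)`. -/
def eta (i : Fin 4) : ℝ := if i = 0 then 1 else -1

/-- The scalar product `a · b` of signature `(1, 3)`. -/
def dot (a b : E) : ℝ := ∑ i, eta i * a i * b i

/-- The scalar product of bivectors, `(a ∧ b) · (c ∧ d)`. -/
def wedgeDot (a b c d : E) : ℝ := dot a c * dot b d - dot a d * dot b c

/-- `‖a ∧ b‖² = (a ∧ b) · (a ∧ b)`, a signed quantity. -/
def wedgeSq (a b : E) : ℝ := wedgeDot a b a b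

/-- `‖a‖ = |a · a|^{1/2}`. Even powers of the norm are always written as signed squares `dot a a`,
so that `‖a‖³` appears as `dot a a * nrm a`. -/
def nrm (a : E) : ℝ := √|dot a a|

/-- `‖a ∧ b‖ = |‖a ∧ b‖²|^{1/2}`; `‖a ∧ b‖³` appears as `wedgeSq a b * wedgeNrm a b`, and
`‖a ∧ b‖⁵` as `wedgeSq a b ^ 2 * wedgeNrm a b`. -/
def wedgeNrm (a b : E) : ℝ := √|wedgeSq a b|

/-- `ε_{αβγδ} a^α b^β c^γ d^δ`, with `ε₀₁₂₃ = 1`; this is also `∗ a ∧ b ∧ c ∧ d`. -/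
def vol (a b c d : E) : ℝ := Matrix.det (Matrix.of ![a, b, c, d])

/-- The vector `∗ a ∧ b ∧ c`, with covariant components
`(∗ a ∧ b ∧ c)_δ = ε_{αβγδ} a^α b^β c^γ`. -/
def star3 (a b c : E) : E := fun i => eta i * vol a b c (Pi.single i 1)

/-- The vector with covariant components `ε_{αβγδ} a^β b^γ c^δ`. -/
def epsVec (a b c : E) : E := fun i => eta i * vol (Pi.single i 1) a b c

/-! ### The equation of motion

In what follows `u`, `w`, `j` stand for the velocity and for its first and second derivatives. -/

/-- The left-hand side of Mathisson's equation of the free relativistic top of mass `m` and spin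
four-vector `s`, in terms of the spin four-vector. -/
def mathissonVec (m : ℝ) (s u w j : E) : E :=
  epsVec j u s - (3 * (dot w u / dot u u)) • epsVec w u s - m • (dot u u • w - dot w u • u)

/-- The left-hand side of the variational parameter-invariant third-order equation. -/
def topVec (m : ℝ) (s u w j : E) : E :=
  (1 / (wedgeSq s u * wedgeNrm s u)) • star3 j u s
    - (3 * (wedgeDot w s u s / (wedgeSq s u ^ 2 * wedgeNrm s u))) • star3 w u s
    + (m / (dot s s * nrm s)) •
        ((1 / nrm u) • w - (dot w u / (dot u u * nrm u)) • u)

/-- The Lagrange function `𝓛` attached to the mass `m`, the spin `s` and the vector `e`. It is a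
function of the position `x`, the velocity `u` and the acceleration `w`. -/
def lagrangian (m : ℝ) (s e : E) (_x u w : E) : ℝ :=
  vol w u s e / (dot s s * wedgeNrm s u) *
      ((dot s s * dot u e - dot s u * dot s e) /
        (dot (dot u e • s - dot s e • u) (dot u e • s - dot s e • u) - dot e e * wedgeSq s u))
    - m / (dot s s * nrm s) * nrm u

/-- The Euler–Lagrange (Euler–Poisson) expression of a second-order Lagrange function along a
curve `c`, contracted with a vector `h`:
`h^α (∂𝓛/∂x^α - d/dτ ∂𝓛/∂u^α + d²/dτ² ∂𝓛/∂u̇^α)`. -/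
def eulerLagrange (L : E → E → E → ℝ) (c : ℝ → E) (t : ℝ) (h : E) : ℝ :=
  fderiv ℝ (fun x => L x (deriv c t) (iteratedDeriv 2 c t)) (c t) h
    - deriv (fun τ => fderiv ℝ (fun u => L (c τ) u (iteratedDeriv 2 c τ)) (deriv c τ) h) t
    + iteratedDeriv 2 (fun τ => fderiv ℝ (fun w => L (c τ) (deriv c τ) w)
        (iteratedDeriv 2 c τ) h) t

/-! ### Second-order connections -/

/-- The Liouville field `ζ¹ = u ∂/∂u + 2 u̇ ∂/∂u̇` on the second-order velocity space. -/
def zeta1 (p : E × E × E) : E × E × E := (0, p.2.1, (2 : ℝ) • p.2.2)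

/-- The Liouville field `ζ² = u ∂/∂u̇` on the second-order velocity space. -/
def zeta2 (p : E × E × E) : E × E × E := (0, 0, p.2.1)

/-- The vector field `u ∂/∂x + u̇ ∂/∂u + ξ ∂/∂u̇` of the third-order equation `ü = ξ(u̇, u)`. -/
def spray (ξ : E → E → E) (p : E × E × E) : E × E × E := (p.2.1, p.2.2, ξ p.2.2 p.2.1)

/-- The commutation relations with the Liouville fields which say that the equation
`ü = ξ(u̇, u)` is the equation of the autoparallel curves of a second-order connection: modulo the
fields `ζ¹`, `ζ²` tangent to the reparametrizations, `[ζ¹, ξ] = ξ` and `[ζ², ξ] = 0`. In local form: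
`u̇ - ⅓ u^β ∂ξ/∂u̇^β = κ u` and `ξ - ⅓ u^β ∂ξ/∂u^β - ⅔ u̇^β ∂ξ/∂u̇^β = μ u`.
They are imposed over the timelike velocities. -/
def IsAutoparallelField (ξ : E → E → E) (κ μ : ℝ) : Prop :=
  ∀ p : E × E × E, 0 < dot p.2.1 p.2.1 →
    DifferentiableAt ℝ (spray ξ) p ∧
    VectorField.lieBracket ℝ zeta1 (spray ξ) p = spray ξ p - (3 * μ) • zeta2 p ∧
    VectorField.lieBracket ℝ zeta2 (spray ξ) p = zeta1 p - (3 * κ) • zeta2 p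

/-- The right-hand side `ξ(u̇, u)` of the equation solved for `ü`, when the parametrization is
prescribed by `ü · u = ‖u‖² Ψ(u̇, u)`. -/
def solvedField (m : ℝ) (s : E) (Ψ : E → E → ℝ) (w u : E) : E :=
  (3 * (dot w u / dot u u)) • w - (3 * (dot w u ^ 2 / dot u u ^ 2)) • u
    - (m * (wedgeNrm u s / (dot s s * nrm s * nrm u))) • star3 w u s
    + Ψ w u • u

/-- `Ψ = 3 ‖u‖⁻² (½ ‖u̇‖² + f(‖u̇ ∧ u‖))`. -/
def paramFun (f : ℝ → ℝ) (w u : E) : ℝ :=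
  3 / dot u u * (1 / 2 * dot w w + f (wedgeNrm w u))

/-- The right-hand side of the autoparallel equation with the constant `A`. -/
def topField (m A : ℝ) (s : E) (w u : E) : E :=
  (3 * (dot w u / dot u u)) • w
    - (3 * (dot w u ^ 2 / dot u u ^ 2 - 1 / 2 * (dot w w / dot u u)
        - A * (wedgeNrm w u ^ (4 / 3 : ℝ) / dot u u))) • u
    - (m * (wedgeNrm u s / (dot s s * nrm s * nrm u))) • star3 w u s

/-! ### Curves -/

/-- `c` is a timelike curve of class `C³` on the open interval `I`. -/
structure IsTimelikeCurve (c : ℝ → E) (I : Set ℝ) : Prop where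
  isOpen : IsOpen I
  ordConnected : I.OrdConnected
  contDiffOn : ContDiffOn ℝ 3 c I
  timelike : ∀ t ∈ I, 0 < dot (deriv c t) (deriv c t)

/-- The constraint `s · u = 0` along the curve `c`. -/
def Pirani (s : E) (c : ℝ → E) (I : Set ℝ) : Prop := ∀ t ∈ I, dot s (deriv c t) = 0

/-- `c` satisfies the parameter-invariant third-order equation on `I`. -/
def IsTopCurve (m : ℝ) (s : E) (c : ℝ → E) (I : Set ℝ) : Prop :=
  ∀ t ∈ I, topVec m s (deriv c t) (iteratedDeriv 2 c t) (iteratedDeriv 3 c t) = 0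

/-- `c` satisfies Mathisson's equation on `I`. -/
def IsMathissonCurve (m : ℝ) (s : E) (c : ℝ → E) (I : Set ℝ) : Prop :=
  ∀ t ∈ I, mathissonVec m s (deriv c t) (iteratedDeriv 2 c t) (iteratedDeriv 3 c t) = 0

/-- The parametrization condition `ü · u = ‖u‖² Ψ(u̇, u)` along `c`. -/
def HasParam (Ψ : E → E → ℝ) (c : ℝ → E) (I : Set ℝ) : Prop :=
  ∀ t ∈ I, dot (iteratedDeriv 3 c t) (deriv c t) =
    dot (deriv c t) (deriv c t) * Ψ (iteratedDeriv 2 c t) (deriv c t)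

/-- `c` is a solution of `ü = ξ(u̇, u)` on `I`. -/
def IsAutoparallel (ξ : E → E → E) (c : ℝ → E) (I : Set ℝ) : Prop :=
  ∀ t ∈ I, iteratedDeriv 3 c t = ξ (iteratedDeriv 2 c t) (deriv c t)

/-- The Lagrange function attached to `e` is regular at the instant `t` of the curve `c`. -/
def RegularAt (s e : E) (c : ℝ → E) (t : ℝ) : Prop :=
  LinearIndependent ℝ ![deriv c t, s, e]

/-- The (unparametrized) curve `c` is a world line of the connection `ξ` with the constraint
`s · u = 0`: near each of its points it can be reparametrized to an autoparallel curve satisfying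
the constraint. -/
def IsWorldLine (ξ : E → E → E) (s : E) (c : ℝ → E) (I : Set ℝ) : Prop :=
  ∀ t ∈ I, ∃ (J : Set ℝ) (φ : ℝ → ℝ), IsOpen J ∧ J.OrdConnected ∧ ContDiffOn ℝ 3 φ J ∧
    (∀ τ ∈ J, deriv φ τ ≠ 0) ∧ Set.MapsTo φ J I ∧ t ∈ φ '' J ∧
    Pirani s (c ∘ φ) J ∧ IsAutoparallel ξ (c ∘ φ) J

end RelTop

end

namespace RelTop

open Filter Topology

/-! ### Algebra of the scalar product and of the volume form -/

/-! The Lagrange function is linear in `u̇`: it is `vol u̇ u s e * coeff s e u` minus a multiple of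
`‖u‖`. The momentum conjugate to `u̇`, paired with `h`, is therefore `B = vol h u s e * coeff s e
u`, and by `coeff_identity` its derivative along the curve is `A + C`, where `A` is the derivative
of the Lagrange function in `u` and `C` no longer involves `e`. The Euler–Lagrange expression `-A' +
B''` collapses to `C'`, which is the third-order equation. The identity itself is the linear
dependence of five vectors in dimension four (`dot_vol_relation`), fed with the gradient of `coeff`
paired with `s`, `u` and `e`. Regularity is used through `gram_neg`: the Gram-type denominator is
negative when `u`, `s`, `e` are independent.

Under the constraint, `u̇` and `ü` are also orthogonal to `s`, so the equation becomes a nonzero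
multiple of Mathisson's. It determines `∗ ü ∧ u ∧ s`, and applying `∗ · ∧ u ∧ s` twice multiplies
vectors orthogonal to `u` and `s` by the nonzero number `‖u ∧ s‖²` (`star3_star3`). Thus only the
component of `ü` along `u` is left free, and the parametrization condition fixes it.

The relation with `ζ¹` is infinitesimal homogeneity under `(u, u̇) ↦ (eʳ u, e²ʳ u̇)`. Integrated and
paired with `u`, it gives `f (e³ʳ x) = e⁴ʳ f x`, which forces the exponent `4/3`. Conversely, the
explicit field is homogeneous and has the right behaviour under `u̇ ↦ u̇ + r u`. It is
differentiable even where `u̇ ∥ u`, because `4/3 > 1`.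

For world lines, equation (1) is parameter-invariant (`topVec_reparam`), so it remains to reach the
distinguished parametrization from an arbitrary one. This prescribes a Schwarzian derivative, a
problem linearized by `y'' = (K/2) y` and `φ' = y(φ)²` (`exists_reparam_schwarzian`). -/

theorem dot_expand (a b : E) : dot a b = a 0 * b 0 - a 1 * b 1 - a 2 * b 2 - a 3 * b 3 := by
  simp [dot, eta, Fin.sum_univ_four]
  ring

theorem vol_expand (a b c d : E) :
    vol a b c d =
      a 0 * (b 1 * (c 2 * d 3 - c 3 * d 2) - b 2 * (c 1 * d 3 - c 3 * d 1)
        + b 3 * (c 1 * d 2 - c 2 * d 1))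
      - a 1 * (b 0 * (c 2 * d 3 - c 3 * d 2) - b 2 * (c 0 * d 3 - c 3 * d 0)
        + b 3 * (c 0 * d 2 - c 2 * d 0))
      + a 2 * (b 0 * (c 1 * d 3 - c 3 * d 1) - b 1 * (c 0 * d 3 - c 3 * d 0)
        + b 3 * (c 0 * d 1 - c 1 * d 0))
      - a 3 * (b 0 * (c 1 * d 2 - c 2 * d 1) - b 1 * (c 0 * d 2 - c 2 * d 0)
        + b 2 * (c 0 * d 1 - c 1 * d 0)) := by
  simp [vol, Matrix.det_succ_row_zero, Fin.sum_univ_succ, Fin.succAbove]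
  ring

theorem dot_comm (a b : E) : dot a b = dot b a := by
  simp only [dot_expand]; ring

@[simp] theorem dot_add_left (a b c : E) : dot (a + b) c = dot a c + dot b c := by
  simp only [dot_expand, Pi.add_apply]; ring

@[simp] theorem dot_add_right (a b c : E) : dot a (b + c) = dot a b + dot a c := by
  simp only [dot_expand, Pi.add_apply]; ring

@[simp] theorem dot_sub_left (a b c : E) : dot (a - b) c = dot a c - dot b c := by
  simp only [dot_expand, Pi.sub_apply]; ring

@[simp] theorem dot_sub_right (a b c : E) : dot a (b - c) = dot a b - dot a c := by
  simp only [dot_expand, Pi.sub_apply]; ring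

@[simp] theorem dot_smul_left (r : ℝ) (a b : E) : dot (r • a) b = r * dot a b := by
  simp only [dot_expand, Pi.smul_apply, smul_eq_mul]; ring

@[simp] theorem dot_smul_right (r : ℝ) (a b : E) : dot a (r • b) = r * dot a b := by
  simp only [dot_expand, Pi.smul_apply, smul_eq_mul]; ring

@[simp] theorem dot_neg_left (a b : E) : dot (-a) b = -dot a b := by
  simp only [dot_expand, Pi.neg_apply]; ring

@[simp] theorem dot_neg_right (a b : E) : dot a (-b) = -dot a b := by
  simp only [dot_expand, Pi.neg_apply]; ring

@[simp] theorem dot_zero_left (a : E) : dot 0 a = 0 := by simp [dot]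

@[simp] theorem dot_zero_right (a : E) : dot a 0 = 0 := by simp [dot]

theorem eq_zero_of_forall_dot {a : E} (h : ∀ b, dot a b = 0) : a = 0 := by
  ext i
  have := h (Pi.single i 1)
  fin_cases i <;> simpa [dot_expand] using this

theorem star3_components (a b c : E) :
    star3 a b c 0 = vol a b c (Pi.single 0 1) ∧ star3 a b c 1 = -vol a b c (Pi.single 1 1) ∧
    star3 a b c 2 = -vol a b c (Pi.single 2 1) ∧ star3 a b c 3 = -vol a b c (Pi.single 3 1) := by
  simp [star3, eta]

theorem dot_star3 (a b c h : E) : dot (star3 a b c) h = vol a b c h := by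
  obtain ⟨h0, h1, h2, h3⟩ := star3_components a b c
  rw [dot_expand, h0, h1, h2, h3]
  simp [vol_expand]
  ring

theorem epsVec_eq_neg_star3 (a b c : E) : epsVec a b c = -star3 a b c := by
  ext i
  simp only [epsVec, star3, Pi.neg_apply, vol_expand]
  ring

theorem vol_add_left (a a' b c d : E) : vol (a + a') b c d = vol a b c d + vol a' b c d := by
  simp only [vol_expand, Pi.add_apply]; ring

theorem vol_smul_left (r : ℝ) (a b c d : E) : vol (r • a) b c d = r * vol a b c d := by
  simp only [vol_expand, Pi.smul_apply, smul_eq_mul]; ring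

theorem vol_smul_second (r : ℝ) (a b c d : E) : vol a (r • b) c d = r * vol a b c d := by
  simp only [vol_expand, Pi.smul_apply, smul_eq_mul]; ring

theorem vol_self_left (a c d : E) : vol a a c d = 0 := by
  simp only [vol_expand]; ring

theorem vol_swap_left (a b c d : E) : vol a b c d = -vol b a c d := by
  simp only [vol_expand]; ring

theorem vol_rotate (a b c d : E) : vol a b c d = -vol d a b c := by
  simp only [vol_expand]; ring

theorem star3_add_left (a a' b c : E) : star3 (a + a') b c = star3 a b c + star3 a' b c := by
  ext i; simp only [star3, vol_add_left, Pi.add_apply]; ring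

theorem star3_smul_left (r : ℝ) (a b c : E) : star3 (r • a) b c = r • star3 a b c := by
  ext i; simp only [star3, vol_smul_left, Pi.smul_apply, smul_eq_mul]; ring

theorem star3_sub_left (a a' b c : E) : star3 (a - a') b c = star3 a b c - star3 a' b c := by
  rw [sub_eq_add_neg, ← neg_one_smul ℝ a', star3_add_left, star3_smul_left]; module

theorem star3_smul_second (r : ℝ) (a b c : E) : star3 a (r • b) c = r • star3 a b c := by
  ext i; simp only [star3, vol_smul_second, Pi.smul_apply, smul_eq_mul]; ring

theorem star3_self_left (a c : E) : star3 a a c = 0 := by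
  ext i; simp [star3, vol_self_left]

theorem dot_star3_second (a b c : E) : dot (star3 a b c) b = 0 := by
  rw [dot_star3]; simp only [vol_expand]; ring

theorem dot_star3_third (a b c : E) : dot (star3 a b c) c = 0 := by
  rw [dot_star3]; simp only [vol_expand]; ring

theorem wedgeSq_eq (a b : E) : wedgeSq a b = dot a a * dot b b - dot a b ^ 2 := by
  rw [wedgeSq, wedgeDot, dot_comm b a]; ring

theorem wedgeSq_comm (a b : E) : wedgeSq a b = wedgeSq b a := by
  rw [wedgeSq_eq, wedgeSq_eq, dot_comm b a]; ring

theorem wedgeNrm_comm (a b : E) : wedgeNrm a b = wedgeNrm b a := by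
  rw [wedgeNrm, wedgeNrm, wedgeSq_comm]

/-- The linear relation between five vectors, paired with the covector `dot k`. -/
theorem dot_vol_relation (k h w u s e : E) :
    dot k h * vol w u s e - dot k w * vol h u s e + dot k u * vol h w s e
      - dot k s * vol h w u e + dot k e * vol h w u s = 0 := by
  simp only [vol_expand, dot_expand]; ring

/-- Double duality: up to the factor `‖u ∧ s‖²` the right side is the projection of `w` off the
plane of `u` and `s`. This is how `∗ · ∧ u ∧ s` gets inverted on the orthogonal complement of that
plane. -/
theorem star3_star3 (w u s : E) :
    star3 (star3 w u s) u s = wedgeSq u s • w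
      - (dot w u * dot s s - dot w s * dot u s) • u
      - (dot w s * dot u u - dot w u * dot u s) • s := by
  obtain ⟨h0, h1, h2, h3⟩ := star3_components w u s
  obtain ⟨k0, k1, k2, k3⟩ := star3_components (star3 w u s) u s
  ext i
  fin_cases i
  · simp only [Fin.zero_eta, k0, vol_expand (star3 w u s), h0, h1, h2, h3]
    simp [vol_expand, wedgeSq_eq, dot_expand]; ring
  · simp only [Fin.mk_one, k1, vol_expand (star3 w u s), h0, h1, h2, h3]
    simp [vol_expand, wedgeSq_eq, dot_expand]; ring
  · simp only [Fin.reduceFinMk, k2, vol_expand (star3 w u s), h0, h1, h2, h3]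
    simp [vol_expand, wedgeSq_eq, dot_expand]; ring
  · simp only [Fin.reduceFinMk, k3, vol_expand (star3 w u s), h0, h1, h2, h3]
    simp [vol_expand, wedgeSq_eq, dot_expand]; ring

/-! ### Consequences of the signature -/

/-- Cauchy–Schwarz for the spatial parts: orthogonality bounds `(v₀ u₀)²` by the product of the
spatial squares `V` and `U`, while `U < u₀²` as `u` is timelike. -/
theorem dot_self_nonpos_of_orthogonal {u v : E} (hu : 0 < dot u u) (h : dot v u = 0) :
    dot v v ≤ 0 ∧ (dot v v = 0 → v = 0) := by
  rw [dot_expand] at hu h ⊢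
  have cs : (v 0 * u 0) ^ 2 ≤ (v 1 ^ 2 + v 2 ^ 2 + v 3 ^ 2) * (u 1 ^ 2 + u 2 ^ 2 + u 3 ^ 2) := by
    rw [show v 0 * u 0 = v 1 * u 1 + v 2 * u 2 + v 3 * u 3 by linarith]
    nlinarith [sq_nonneg (v 1 * u 2 - v 2 * u 1), sq_nonneg (v 1 * u 3 - v 3 * u 1),
      sq_nonneg (v 2 * u 3 - v 3 * u 2)]
  have hV : 0 ≤ v 1 ^ 2 + v 2 ^ 2 + v 3 ^ 2 := by positivity
  have hU : 0 ≤ u 1 ^ 2 + u 2 ^ 2 + u 3 ^ 2 := by positivity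
  generalize hVd : v 1 ^ 2 + v 2 ^ 2 + v 3 ^ 2 = V at *
  generalize hUd : u 1 ^ 2 + u 2 ^ 2 + u 3 ^ 2 = U at *
  have hu0 : U < u 0 ^ 2 := by nlinarith
  have key : (v 0 ^ 2 - V) * u 0 ^ 2 ≤ V * (U - u 0 ^ 2) := by nlinarith
  have hle : V * (U - u 0 ^ 2) ≤ 0 := mul_nonpos_of_nonneg_of_nonpos hV (by linarith)
  constructor
  · by_contra! hc
    have : 0 < (v 0 ^ 2 - V) * u 0 ^ 2 := mul_pos (by nlinarith) (by linarith)
    linarith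
  · intro h0
    have h0' : v 0 ^ 2 - V = 0 := by nlinarith
    have hV0 : V = 0 := by
      rw [h0', zero_mul] at key
      have := le_antisymm hle key
      rcases mul_eq_zero.1 this with h | h
      · exact h
      · linarith
    have e1 : v 1 = 0 := by nlinarith [sq_nonneg (v 1), sq_nonneg (v 2), sq_nonneg (v 3)]
    have e2 : v 2 = 0 := by nlinarith [sq_nonneg (v 1), sq_nonneg (v 2), sq_nonneg (v 3)]
    have e3 : v 3 = 0 := by nlinarith [sq_nonneg (v 1), sq_nonneg (v 2), sq_nonneg (v 3)]
    have e0 : v 0 = 0 := by nlinarith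
    ext i
    fin_cases i <;> simpa

theorem wedgeSq_neg {u s : E} (hu : 0 < dot u u) (hs : dot s s < 0) : wedgeSq s u < 0 := by
  rw [wedgeSq_eq]
  nlinarith [mul_pos_of_neg_of_neg hs (neg_neg_of_pos hu), sq_nonneg (dot s u)]

/-- Up to sign, the Gram determinant of `s`, `u`, `e`. -/
def gram (s e u : E) : ℝ :=
  dot (dot u e • s - dot s e • u) (dot u e • s - dot s e • u) - dot e e * wedgeSq s u

theorem gram_eq (s e u : E) : gram s e u =
    dot u e ^ 2 * dot s s - 2 * (dot u e * dot s e * dot s u) + dot s e ^ 2 * dot u u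
      - dot e e * wedgeSq s u := by
  simp only [gram, dot_sub_left, dot_sub_right, dot_smul_left, dot_smul_right, dot_comm u s]; ring

theorem dot_star3_star3 (s e u : E) : dot (star3 e u s) (star3 e u s) = gram s e u := by
  have h := congrArg (fun v => dot v e) (star3_star3 e u s)
  simp only [dot_star3, dot_sub_left, dot_smul_left] at h
  have h' : vol e u s (star3 e u s) = -vol (star3 e u s) u s e := by
    simp only [vol_expand]; ring
  rw [dot_star3, h', h, gram_eq, wedgeSq_comm s u, dot_comm s u, dot_comm s e, dot_comm u e]
  ring

/-- `gram` is the square of `∗ e ∧ u ∧ s`, a vector orthogonal to the timelike `u`; so it is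
negative unless this vector vanishes. In that case double duality gives a linear relation among `u`,
`s`, `e`. -/
theorem gram_neg {s e u : E} (hs : dot s s < 0) (hu : 0 < dot u u)
    (h : LinearIndependent ℝ ![u, s, e]) : gram s e u < 0 := by
  rw [← dot_star3_star3]
  obtain ⟨h1, h2⟩ := dot_self_nonpos_of_orthogonal hu (dot_star3_second e u s)
  refine lt_of_le_of_ne h1 fun h0 => (wedgeSq_neg hu hs).ne ?_
  have h3 := star3_star3 e u s
  rw [h2 h0, show star3 0 u s = 0 by simpa using star3_smul_left 0 0 u s] at h3
  -- The coefficients are those of `star3_star3` with left side zero; the one at `e` is `wedgeSq u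
  -- s`, which cannot vanish.
  have h4 := Fintype.linearIndependent_iff.1 h
    ![-(dot e u * dot s s - dot e s * dot u s), -(dot e s * dot u u - dot e u * dot u s),
      wedgeSq u s]
    (by simp only [Fin.sum_univ_three, Matrix.cons_val]; rw [h3]; module) 2
  rw [wedgeSq_comm]
  simpa using h4


/-! ### Derivatives of scalar products and norms -/

/-- The linear form `dot k`. -/
noncomputable def dotL (k : E) : E →L[ℝ] ℝ :=
  LinearMap.toContinuousLinearMap
    { toFun := dot k, map_add' := dot_add_right k, map_smul' := fun r a => dot_smul_right r k a }

@[simp] theorem dotL_apply (k h : E) : dotL k h = dot k h := rfl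

theorem hasFDerivAt_dot_right (k u : E) : HasFDerivAt (dot k) (dotL k) u := (dotL k).hasFDerivAt

theorem hasFDerivAt_dot_left (k u : E) : HasFDerivAt (fun v => dot v k) (dotL k) u := by
  simpa only [dot_comm _ k] using hasFDerivAt_dot_right k u

theorem _root_.HasDerivAt.dot {f g : ℝ → E} {f' g' : E} {t : ℝ} (hf : HasDerivAt f f' t)
    (hg : HasDerivAt g g' t) :
    HasDerivAt (fun τ => dot (f τ) (g τ)) (dot f' (g t) + dot (f t) g') t := by
  have hf := hasDerivAt_pi.1 hf
  have hg := hasDerivAt_pi.1 hg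
  simp only [dot_expand]
  refine (((((hf 0).mul (hg 0)).sub ((hf 1).mul (hg 1))).sub ((hf 2).mul (hg 2))).sub
    ((hf 3).mul (hg 3))).congr_deriv ?_
  ring

theorem contDiff_dot : ContDiff ℝ ⊤ fun p : E × E => dot p.1 p.2 := by
  simp only [dot_expand]; fun_prop

theorem hasFDerivAt_dot_self (u : E) : HasFDerivAt (fun v => dot v v) (dotL ((2 : ℝ) • u)) u := by
  have h : DifferentiableAt ℝ (fun v => dot v v) u :=
    (contDiff_dot.comp (contDiff_id.prodMk contDiff_id)).differentiable (by simp) u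
  convert h.hasFDerivAt using 1
  ext v
  have h1 : HasDerivAt (fun r : ℝ => u + r • v) v 0 := by
    simpa using ((hasDerivAt_id (0 : ℝ)).smul_const v).const_add u
  have h2 := h1.dot h1
  have h3 := HasFDerivAt.comp_hasDerivAt (0 : ℝ) (f := fun r : ℝ => u + r • v)
    (by simpa using h.hasFDerivAt) h1
  have := h2.unique h3
  simp [dot_comm v u] at this ⊢
  linarith

theorem hasFDerivAt_wedgeSq (s u : E) :
    HasFDerivAt (wedgeSq s) (dotL ((2 : ℝ) • (dot s s • u - dot s u • s))) u := by
  have h : wedgeSq s = fun v => dot s s * dot v v - dot s v ^ 2 := funext (wedgeSq_eq s)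
  rw [h]
  refine (((hasFDerivAt_dot_self u).const_mul (dot s s)).sub
    ((hasFDerivAt_dot_right s u).pow 2)).congr_fderiv ?_
  ext v
  simp
  ring

theorem hasFDerivAt_gram (s e u : E) :
    HasFDerivAt (gram s e) (dotL ((2 : ℝ) • ((dot u e * dot s s - dot s e * dot s u) • e
      + dot s e ^ 2 • u - (dot u e * dot s e) • s - dot e e • (dot s s • u - dot s u • s)))) u := by
  rw [show gram s e = _ from funext (gram_eq s e)]
  refine ((((((hasFDerivAt_dot_left e u).pow 2).mul_const (dot s s)).sub
    ((((hasFDerivAt_dot_left e u).mul_const (dot s e)).mul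
      (hasFDerivAt_dot_right s u)).const_mul 2)).add
    ((hasFDerivAt_dot_self u).const_mul (dot s e ^ 2))).sub
    ((hasFDerivAt_wedgeSq s u).const_mul (dot e e))).congr_fderiv ?_
  ext v
  simp
  ring

theorem wedgeNrm_sq_of_neg {s u : E} (h : wedgeSq s u < 0) : wedgeNrm s u ^ 2 = -wedgeSq s u := by
  rw [wedgeNrm, Real.sq_sqrt (abs_nonneg _), abs_of_neg h]

theorem wedgeNrm_pos {s u : E} (h : wedgeSq s u ≠ 0) : 0 < wedgeNrm s u :=
  Real.sqrt_pos.2 (abs_pos.2 h)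

theorem nrm_pos {u : E} (h : dot u u ≠ 0) : 0 < nrm u := Real.sqrt_pos.2 (abs_pos.2 h)

theorem nrm_sq_of_pos {u : E} (h : 0 < dot u u) : nrm u ^ 2 = dot u u := by
  rw [nrm, Real.sq_sqrt (abs_nonneg _), abs_of_pos h]

theorem hasFDerivAt_wedgeNrm {s u : E} (h : wedgeSq s u < 0) :
    HasFDerivAt (wedgeNrm s)
      (dotL (-(1 / wedgeNrm s u) • (dot s s • u - dot s u • s))) u := by
  have hX := hasFDerivAt_wedgeSq s u
  have hev : wedgeNrm s =ᶠ[𝓝 u] fun v => √(-wedgeSq s v) := by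
    filter_upwards [hX.continuousAt.eventually_lt continuousAt_const h] with v hv
    rw [wedgeNrm, abs_of_neg hv]
  refine HasFDerivAt.congr_of_eventuallyEq ?_ hev
  refine (hX.neg.sqrt (by simpa using h.ne)).congr_fderiv ?_
  ext v
  rw [hev.eq_of_nhds]
  simp
  ring

theorem hasFDerivAt_nrm {u : E} (h : 0 < dot u u) :
    HasFDerivAt nrm (dotL ((1 / nrm u) • u)) u := by
  have hX := hasFDerivAt_dot_self u
  have hev : nrm =ᶠ[𝓝 u] fun v => √(dot v v) := by
    filter_upwards [continuousAt_const.eventually_lt hX.continuousAt h] with v hv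
    rw [nrm, abs_of_pos hv]
  refine HasFDerivAt.congr_of_eventuallyEq ?_ hev
  refine (hX.sqrt h.ne').congr_fderiv ?_
  ext v
  rw [hev.eq_of_nhds]
  simp
  ring

/-! ### The coefficient of the Lagrange function -/

/-- The factor of `vol u̇ u s e` in the Lagrange function. -/
noncomputable def coeff (s e u : E) : ℝ :=
  1 / (dot s s * wedgeNrm s u) * ((dot s s * dot u e - dot s u * dot s e) / gram s e u)

theorem lagrangian_eq (m : ℝ) (s e x u w : E) :
    lagrangian m s e x u w = vol w u s e * coeff s e u - m / (dot s s * nrm s) * nrm u := by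
  simp only [lagrangian, coeff, gram]
  ring

/-- The gradient of `coeff s e`. -/
noncomputable def coeffGrad (s e u : E) : E :=
  (1 / (dot s s * wedgeNrm s u * gram s e u)) • (dot s s • e - dot s e • s)
  + ((dot s s * dot u e - dot s u * dot s e) / (dot s s * wedgeNrm s u ^ 3 * gram s e u)) •
      (dot s s • u - dot s u • s)
  - ((dot s s * dot u e - dot s u * dot s e) / (dot s s * wedgeNrm s u * gram s e u ^ 2)) •
    ((2 : ℝ) • ((dot u e * dot s s - dot s e * dot s u) • e
      + dot s e ^ 2 • u - (dot u e * dot s e) • s - dot e e • (dot s s • u - dot s u • s)))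

theorem hasFDerivAt_coeff {s e u : E} (hs : dot s s ≠ 0) (hX : wedgeSq s u < 0)
    (hQ : gram s e u ≠ 0) : HasFDerivAt (coeff s e) (dotL (coeffGrad s e u)) u := by
  have hN := (wedgeNrm_pos hX.ne).ne'
  have hR := ((hasFDerivAt_dot_left e u).const_mul (dot s s)).sub
    ((hasFDerivAt_dot_right s u).mul_const (dot s e))
  have hD := (((hasFDerivAt_wedgeNrm hX).const_mul (dot s s)).mul (hasFDerivAt_gram s e u))
  have h := hR.mul ((hasDerivAt_inv (mul_ne_zero (mul_ne_zero hs hN) hQ)).comp_hasFDerivAt u hD)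
  refine (h.congr_of_eventuallyEq (Eventually.of_forall fun v => ?_)).congr_fderiv ?_
  · simp only [coeff, Function.comp, Pi.mul_apply, Pi.sub_apply]
    rw [mul_inv]; ring
  · ext v
    simp [coeffGrad]
    field_simp
    ring

/-- Reflects the invariance of `coeff` under `u ↦ u + r s`: each of its ingredients depends on `u`
only modulo `s`. -/
theorem dot_coeffGrad_spin {s u : E} (e : E) : dot (coeffGrad s e u) s = 0 := by
  simp only [coeffGrad, dot_add_left, dot_sub_left, dot_smul_left, dot_comm e s, dot_comm u s]
  ring

/-- Euler's relation: `coeff` is positively homogeneous of degree `1 - 1 - 2 = -2` in `u`. -/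
theorem dot_coeffGrad_self {s e u : E} (hs : dot s s ≠ 0) (hX : wedgeSq s u < 0)
    (hQ : gram s e u ≠ 0) : dot (coeffGrad s e u) u = -2 * coeff s e u := by
  have hN := (wedgeNrm_pos hX.ne).ne'
  have hN2 := wedgeNrm_sq_of_neg hX
  have hq := gram_eq s e u
  rw [wedgeSq_eq] at hN2 hq
  simp only [coeffGrad, coeff, dot_add_left, dot_sub_left, dot_smul_left, dot_comm e u]
  generalize wedgeNrm s u = N at *
  generalize gram s e u = Q at *
  generalize dot s s = a at *
  generalize dot u u = b at *
  generalize dot e e = c at *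
  generalize dot u e = r at *
  generalize dot s e = q at *
  generalize dot s u = p at *
  have h1 : a * b - p * p = -N ^ 2 := by linarith
  have h2 : (2 : ℝ) * ((r * a - q * p) * r + q ^ 2 * b - r * q * p - c * (a * b - p * p)) = 2 * Q := by
    rw [hq]; ring
  rw [h1] at h2 ⊢
  rw [h2]
  field_simp
  ring

/-- The pairing in which `e` disappears, which is the reason for the particular shape of the
Lagrange function. The `gram` gradient is orthogonal to `e`, and what remains simplifies by the
determinant identity `h3`. -/
theorem dot_coeffGrad_aux {s e u : E} (hs : dot s s ≠ 0) (hX : wedgeSq s u < 0)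
    (hQ : gram s e u ≠ 0) :
    dot (coeffGrad s e u) e = -(1 / (wedgeSq s u * wedgeNrm s u)) := by
  have hN := (wedgeNrm_pos hX.ne).ne'
  have hN2 := wedgeNrm_sq_of_neg hX
  have hq := gram_eq s e u
  rw [show wedgeSq s u = -wedgeNrm s u ^ 2 by linarith] at hq ⊢
  rw [wedgeSq_eq] at hN2
  simp only [coeffGrad, dot_add_left, dot_sub_left, dot_smul_left]
  generalize wedgeNrm s u = N at *
  generalize gram s e u = Q at *
  generalize dot s s = a at *
  generalize dot u u = b at *
  generalize dot e e = c at *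
  generalize dot u e = r at *
  generalize dot s e = q at *
  generalize dot s u = p at *
  have h2 : (2 : ℝ) * ((r * a - q * p) * c + q ^ 2 * r - r * q * q - c * (a * r - p * q)) = 0 := by
    ring
  rw [h2]
  have h3 : a * Q = (a * r - p * q) ^ 2 + (a * c - q ^ 2) * N ^ 2 := by
    rw [hq]
    have : a * b = p ^ 2 - N ^ 2 := by linarith
    linear_combination q ^ 2 * this
  field_simp
  linear_combination -Q * h3

/-- The identity between first derivatives which makes the Euler–Lagrange expression independent
of the auxiliary vector. -/
theorem coeff_identity {s e u : E} (hs : dot s s ≠ 0) (hX : wedgeSq s u < 0)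
    (hQ : gram s e u ≠ 0) (h w : E) :
    2 * coeff s e u * vol h w s e + vol h u s e * dot (coeffGrad s e u) w
      - vol w u s e * dot (coeffGrad s e u) h
      = vol w u s h * (1 / (wedgeSq s u * wedgeNrm s u)) := by
  -- The covector of the five-vector relation is the gradient itself, so its pairings with `u`, `s`,
  -- `e` can be replaced by their known values.
  have h1 := dot_vol_relation (coeffGrad s e u) h w u s e
  rw [dot_coeffGrad_spin, dot_coeffGrad_self hs hX hQ, dot_coeffGrad_aux hs hX hQ] at h1
  rw [vol_rotate w u s h]
  linear_combination -h1


/-! ### Derivatives along a curve -/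

section Curve

variable {F : Type*} [NormedAddCommGroup F] [NormedSpace ℝ F] {c : ℝ → F} {I : Set ℝ} {t : ℝ}

theorem hasDerivAt_of_contDiffOn (hI : IsOpen I) (hc : ContDiffOn ℝ 3 c I) (ht : t ∈ I) :
    HasDerivAt c (deriv c t) t :=
  ((hc.differentiableOn (by simp)).differentiableAt (hI.mem_nhds ht)).hasDerivAt

theorem contDiffOn_deriv_two (hI : IsOpen I) (hc : ContDiffOn ℝ 3 c I) :
    ContDiffOn ℝ 2 (deriv c) I :=
  hc.deriv_of_isOpen hI (by norm_num)

theorem contDiffOn_iteratedDeriv_two (hI : IsOpen I) (hc : ContDiffOn ℝ 3 c I) :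
    ContDiffOn ℝ 1 (iteratedDeriv 2 c) I := by
  rw [iteratedDeriv_succ, iteratedDeriv_one]
  exact (contDiffOn_deriv_two hI hc).deriv_of_isOpen hI (by norm_num)

theorem hasDerivAt_deriv (hI : IsOpen I) (hc : ContDiffOn ℝ 3 c I) (ht : t ∈ I) :
    HasDerivAt (deriv c) (iteratedDeriv 2 c t) t := by
  rw [iteratedDeriv_succ, iteratedDeriv_one]
  exact (((contDiffOn_deriv_two hI hc).differentiableOn (by simp)).differentiableAt
    (hI.mem_nhds ht)).hasDerivAt

theorem hasDerivAt_iteratedDeriv_two (hI : IsOpen I) (hc : ContDiffOn ℝ 3 c I) (ht : t ∈ I) :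
    HasDerivAt (iteratedDeriv 2 c) (iteratedDeriv 3 c t) t := by
  rw [iteratedDeriv_succ (n := 2)]
  exact (((contDiffOn_iteratedDeriv_two hI hc).differentiableOn (by simp)).differentiableAt
    (hI.mem_nhds ht)).hasDerivAt

theorem continuousOn_iteratedDeriv_three (hI : IsOpen I) (hc : ContDiffOn ℝ 3 c I) :
    ContinuousOn (iteratedDeriv 3 c) I := by
  rw [iteratedDeriv_succ (n := 2)]
  exact ((contDiffOn_iteratedDeriv_two hI hc).deriv_of_isOpen hI (m := 0) (by norm_num)).continuousOn

end Curve

/-! ### The Euler–Lagrange expression -/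

theorem vol_eq_dot_second (w u s e : E) : vol w u s e = dot (star3 w s e) u := by
  rw [dot_star3]; simp only [vol_expand]; ring

theorem vol_eq_dot_first (w u s e : E) : vol w u s e = dot (-star3 u s e) w := by
  rw [dot_neg_left, dot_star3, vol_rotate u, neg_neg]

theorem hasFDerivAt_vol_second (w u s e : E) :
    HasFDerivAt (fun v => vol w v s e) (dotL (star3 w s e)) u := by
  simpa only [vol_eq_dot_second w _ s e] using hasFDerivAt_dot_right (star3 w s e) u

theorem hasFDerivAt_vol_first (w u s e : E) :
    HasFDerivAt (fun v => vol v u s e) (dotL (-star3 u s e)) w := by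
  simpa only [vol_eq_dot_first _ u s e] using hasFDerivAt_dot_right (-star3 u s e) w

theorem _root_.HasDerivAt.vol {f g : ℝ → E} {f' g' : E} {t : ℝ} (hf : HasDerivAt f f' t)
    (hg : HasDerivAt g g' t) (s e : E) :
    HasDerivAt (fun τ => vol (f τ) (g τ) s e) (vol f' (g t) s e + vol (f t) g' s e) t := by
  have hf := hasDerivAt_pi.1 hf
  have hg := hasDerivAt_pi.1 hg
  have key : ∀ i j, HasDerivAt (fun τ => f τ i * g τ j - f τ j * g τ i)
      (f' i * g t j + f t i * g' j - (f' j * g t i + f t j * g' i)) t :=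
    fun i j => ((hf i).mul (hg j)).sub ((hf j).mul (hg i))
  -- Laplace expansion along the first two rows: only the `2 × 2` minors of the moving pair vary.
  have hv : ∀ a b : E, RelTop.vol a b s e =
      (a 0 * b 1 - a 1 * b 0) * (s 2 * e 3 - s 3 * e 2)
      - (a 0 * b 2 - a 2 * b 0) * (s 1 * e 3 - s 3 * e 1)
      + (a 0 * b 3 - a 3 * b 0) * (s 1 * e 2 - s 2 * e 1)
      + (a 1 * b 2 - a 2 * b 1) * (s 0 * e 3 - s 3 * e 0)
      - (a 1 * b 3 - a 3 * b 1) * (s 0 * e 2 - s 2 * e 0)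
      + (a 2 * b 3 - a 3 * b 2) * (s 0 * e 1 - s 1 * e 0) := fun a b => by
    rw [vol_expand]; ring
  simp only [hv]
  refine ((((((key 0 1).mul_const _).sub ((key 0 2).mul_const _)).add
    ((key 0 3).mul_const _)).add ((key 1 2).mul_const _)).sub ((key 1 3).mul_const _)).add
    ((key 2 3).mul_const _) |>.congr_deriv ?_
  ring

theorem differentiableAt_coeffGrad {s e u : E} (hs : dot s s ≠ 0) (hX : wedgeSq s u < 0)
    (hQ : gram s e u ≠ 0) : DifferentiableAt ℝ (coeffGrad s e) u := by
  have hN := (wedgeNrm_pos hX.ne).ne'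
  have h1 := (hasFDerivAt_wedgeNrm hX).differentiableAt
  have h2 := (hasFDerivAt_gram s e u).differentiableAt
  have h3 := (hasFDerivAt_dot_left e u).differentiableAt
  have h4 := (hasFDerivAt_dot_right s u).differentiableAt
  have hD1 : dot s s * wedgeNrm s u * gram s e u ≠ 0 := by positivity
  have hD2 : dot s s * wedgeNrm s u ^ 3 * gram s e u ≠ 0 := by positivity
  have hD3 : dot s s * wedgeNrm s u * gram s e u ^ 2 ≠ 0 := by positivity
  unfold coeffGrad
  fun_prop (disch := assumption)

theorem fderiv_lagrangian_velocity (m : ℝ) {s e u : E} (hs : dot s s < 0) (hu : 0 < dot u u)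
    (hQ : gram s e u ≠ 0) (x w h : E) :
    fderiv ℝ (fun v => lagrangian m s e x v w) u h =
      vol w h s e * coeff s e u + vol w u s e * dot (coeffGrad s e u) h
        - m / (dot s s * nrm s) * (dot u h / nrm u) := by
  simp only [lagrangian_eq]
  rw [(((hasFDerivAt_vol_second w u s e).fun_mul
    (hasFDerivAt_coeff hs.ne (wedgeSq_neg hu hs) hQ)).fun_sub
    ((hasFDerivAt_nrm hu).const_mul (m / (dot s s * nrm s)))).fderiv]
  simp [vol_eq_dot_second w _ s e]
  ring

theorem fderiv_lagrangian_acceleration (m : ℝ) (s e x u w h : E) :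
    fderiv ℝ (fun v => lagrangian m s e x u v) w h = vol h u s e * coeff s e u := by
  simp only [lagrangian_eq]
  rw [(((hasFDerivAt_vol_first w u s e).mul_const (coeff s e u)).sub_const _).fderiv]
  simp [vol_eq_dot_first _ u s e]
  ring

theorem eulerLagrange_lagrangian {c : ℝ → E} {I : Set ℝ} (m : ℝ) {s e : E}
    (hs : dot s s < 0) (hc : IsTimelikeCurve c I) {t : ℝ} (ht : t ∈ I) (he : RegularAt s e c t) (h : E) :
    eulerLagrange (lagrangian m s e) c t h =
      dot (topVec m s (deriv c t) (iteratedDeriv 2 c t) (iteratedDeriv 3 c t)) h := by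
  have hI := hc.isOpen
  have hQt : gram s e (deriv c t) ≠ 0 := (gram_neg hs (hc.timelike t ht) he).ne
  have hw : ∀ τ ∈ I, HasDerivAt (deriv c) (iteratedDeriv 2 c τ) τ := fun τ hτ =>
    hasDerivAt_deriv hI hc.contDiffOn hτ
  have hj := hasDerivAt_iteratedDeriv_two hI hc.contDiffOn ht
  -- Regularity at the single instant `t` is enough: the nonvanishing of `gram` is an open
  -- condition.
  have hev : ∀ᶠ τ in 𝓝 t, τ ∈ I ∧ gram s e (deriv c τ) ≠ 0 :=
    (hI.eventually_mem ht).and (((hasFDerivAt_gram s e _).continuousAt.comp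
      (hw t ht).continuousAt).eventually_ne hQt)
  have hX : ∀ τ ∈ I, wedgeSq s (deriv c τ) < 0 := fun τ hτ => wedgeSq_neg (hc.timelike τ hτ) hs
  have hut := hw t ht
  have hXt := hX t ht
  have hNt := (wedgeNrm_pos hXt.ne).ne'
  have hnt := (nrm_pos (hc.timelike t ht).ne').ne'
  set A : ℝ → ℝ := fun τ =>
    vol (iteratedDeriv 2 c τ) h s e * coeff s e (deriv c τ)
      + vol (iteratedDeriv 2 c τ) (deriv c τ) s e * dot (coeffGrad s e (deriv c τ)) h
      - m / (dot s s * nrm s) * (dot (deriv c τ) h / nrm (deriv c τ)) with hA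
  set C : ℝ → ℝ := fun τ =>
    vol (iteratedDeriv 2 c τ) (deriv c τ) s h *
        (wedgeSq s (deriv c τ) * wedgeNrm s (deriv c τ))⁻¹
      + m / (dot s s * nrm s) * (dot (deriv c τ) h * (nrm (deriv c τ))⁻¹) with hC
  have hnrm := (hasFDerivAt_nrm (hc.timelike t ht)).comp_hasDerivAt t hut
  have hcoeff := (hasFDerivAt_coeff hs.ne hXt hQt).comp_hasDerivAt t hut
  have hAd : DifferentiableAt ℝ A t := by
    have g1 := (hj.vol (hasDerivAt_const t h) s e).differentiableAt
    have g2 := (hj.vol hut s e).differentiableAt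
    have g3 := (((differentiableAt_coeffGrad hs.ne hXt hQt).comp t hut.differentiableAt).hasDerivAt.dot
      (hasDerivAt_const t h)).differentiableAt
    have g4 := (hut.dot (hasDerivAt_const t h)).differentiableAt
    exact ((g1.mul hcoeff.differentiableAt).add (g2.mul g3)).sub
      ((g4.div hnrm.differentiableAt hnt).const_mul _)
  have hCd : HasDerivAt C
      (dot (topVec m s (deriv c t) (iteratedDeriv 2 c t) (iteratedDeriv 3 c t)) h) t := by
    have g1 := ((hasFDerivAt_wedgeSq s _).comp_hasDerivAt t hut).mul
      ((hasFDerivAt_wedgeNrm hXt).comp_hasDerivAt t hut)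
    have g2 := (hj.vol hut s h).mul (g1.inv (mul_ne_zero hXt.ne hNt))
    have g3 := ((hut.dot (hasDerivAt_const t h)).mul (hnrm.inv hnt)).const_mul
      (m / (dot s s * nrm s))
    refine (g2.add g3).congr_deriv ?_
    have hN2 := wedgeNrm_sq_of_neg hXt
    have hn2 := nrm_sq_of_pos (hc.timelike t ht)
    simp only [topVec, dot_add_left, dot_sub_left, dot_smul_left, dot_star3, wedgeDot,
      dot_comm (iteratedDeriv 2 c t) (deriv c t), dot_comm (iteratedDeriv 2 c t) s,
      Function.comp, dotL_apply, vol_self_left,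
      dot_zero_right, Pi.mul_apply, Pi.inv_apply, ← hn2, neg_mul]
    rw [show wedgeSq s (deriv c t) = -wedgeNrm s (deriv c t) ^ 2 by linarith]
    field_simp
    ring
  -- The crux: `B' = A + C` near `t`. Neither `A` nor `C` contains a third derivative of the curve,
  -- so `B''` exists although `c` is only `C³`.
  have hB : deriv (fun τ => vol h (deriv c τ) s e * coeff s e (deriv c τ)) =ᶠ[𝓝 t]
      fun τ => A τ + C τ := by
    filter_upwards [hev] with τ ⟨hτ, hQ⟩
    have hd : HasDerivAt (fun τ => vol h (deriv c τ) s e * coeff s e (deriv c τ)) _ τ :=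
      ((hasDerivAt_const τ h).vol (hw τ hτ) s e).mul
        ((hasFDerivAt_coeff hs.ne (hX τ hτ) hQ).comp_hasDerivAt τ (hw τ hτ))
    rw [hd.deriv]
    have := coeff_identity hs.ne (hX τ hτ) hQ h (iteratedDeriv 2 c τ)
    have h0 : vol 0 (deriv c τ) s e = 0 := by simp [vol_expand]
    have h1 := vol_swap_left (iteratedDeriv 2 c τ) h s e
    simp only [hA, hC, dotL_apply, h0, h1, ← one_div]
    linear_combination this
  have h1 : (fun τ => fderiv ℝ (fun u => lagrangian m s e (c τ) u (iteratedDeriv 2 c τ))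
      (deriv c τ) h) =ᶠ[𝓝 t] A := by
    filter_upwards [hev] with τ ⟨hτ, hQ⟩
    exact fderiv_lagrangian_velocity m hs (hc.timelike τ hτ) hQ _ _ _
  have h0 : fderiv ℝ (fun x => lagrangian m s e x (deriv c t) (iteratedDeriv 2 c t)) (c t) h
      = 0 := by
    simp [lagrangian]
  rw [eulerLagrange, h0, h1.deriv_eq]
  simp only [fderiv_lagrangian_acceleration]
  rw [iteratedDeriv_succ, iteratedDeriv_one, hB.deriv_eq,
    (hAd.hasDerivAt.fun_add hCd).deriv]
  ring


/-! ### The equation along constrained curves -/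

section Constraint

variable {m : ℝ} {s u w j : E}

theorem wedgeSq_of_orthogonal (h : dot s u = 0) : wedgeSq s u = dot s s * dot u u := by
  rw [wedgeSq_eq, h]; ring

theorem wedgeNrm_of_orthogonal (h : dot s u = 0) : wedgeNrm s u = nrm s * nrm u := by
  rw [wedgeNrm, wedgeSq_of_orthogonal h, abs_mul, Real.sqrt_mul (abs_nonneg _), nrm, nrm]

theorem mathissonVec_eq (m : ℝ) (s u w j : E) :
    mathissonVec m s u w j = -(star3 j u s - (3 * (dot w u / dot u u)) • star3 w u s
      + m • (dot u u • w - dot w u • u)) := by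
  rw [mathissonVec, epsVec_eq_neg_star3, epsVec_eq_neg_star3]; module

theorem smul_topVec (hs : dot s s < 0) (hu : 0 < dot u u) (hsu : dot s u = 0)
    (hsw : dot s w = 0) :
    (wedgeSq s u * wedgeNrm s u) • topVec m s u w j = -mathissonVec m s u w j := by
  have h1 := (nrm_pos hs.ne).ne'
  have h2 := (nrm_pos hu.ne').ne'
  have h3 := hs.ne
  have h4 := hu.ne'
  rw [mathissonVec_eq, neg_neg, topVec, wedgeDot, wedgeNrm_of_orthogonal hsu,
    wedgeSq_of_orthogonal hsu, dot_comm w s, hsw]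
  match_scalars
  all_goals field_simp
  ring

theorem topVec_eq_zero_iff (hs : dot s s < 0) (hu : 0 < dot u u) (hsu : dot s u = 0)
    (hsw : dot s w = 0) : topVec m s u w j = 0 ↔ mathissonVec m s u w j = 0 := by
  have hX := (wedgeSq_neg hu hs).ne
  rw [← neg_eq_zero (a := mathissonVec m s u w j), ← smul_topVec hs hu hsu hsw,
    smul_eq_zero_iff_right (mul_ne_zero hX (wedgeNrm_pos hX).ne')]

theorem solvedField_of_orthogonal (hs : dot s s < 0) (hu : 0 < dot u u) (hsu : dot s u = 0)
    (Ψ : E → E → ℝ) : solvedField m s Ψ w u =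
      (3 * (dot w u / dot u u)) • w - (3 * (dot w u ^ 2 / dot u u ^ 2)) • u
        - (m / dot s s) • star3 w u s + Ψ w u • u := by
  have h1 := (nrm_pos hs.ne).ne'
  have h2 := (nrm_pos hu.ne').ne'
  have h3 := hs.ne
  rw [solvedField, wedgeNrm_comm, wedgeNrm_of_orthogonal hsu]
  congr 4
  field_simp

theorem mathissonVec_and_param_iff (hs : dot s s < 0) (hu : 0 < dot u u) (hsu : dot s u = 0)
    (hsw : dot s w = 0) (hsj : dot s j = 0) (Ψ : E → E → ℝ) :
    (mathissonVec m s u w j = 0 ∧ dot j u = dot u u * Ψ w u) ↔ j = solvedField m s Ψ w u := by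
  have h3 := hs.ne
  have h4 := hu.ne'
  have hX := (wedgeSq_neg hu hs).ne
  have hus : dot u s = 0 := by rw [dot_comm, hsu]
  have hws : dot w s = 0 := by rw [dot_comm, hsw]
  have hjs : dot j s = 0 := by rw [dot_comm, hsj]
  have hsolved := solvedField_of_orthogonal (m := m) (w := w) hs hu hsu Ψ
  have hu0 : dot (solvedField m s Ψ w u) u = dot u u * Ψ w u := by
    rw [hsolved]
    simp only [dot_add_left, dot_sub_left, dot_smul_left, dot_star3_second]
    field_simp
    ring
  have hs0 : dot (solvedField m s Ψ w u) s = 0 := by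
    rw [hsolved]
    simp only [dot_add_left, dot_sub_left, dot_smul_left, dot_star3_third, hws, hus]
    ring
  have hstar : star3 (solvedField m s Ψ w u) u s =
      (3 * (dot w u / dot u u)) • star3 w u s - m • (dot u u • w - dot w u • u) := by
    rw [hsolved]
    simp only [star3_add_left, star3_sub_left, star3_smul_left, star3_self_left, star3_star3,
      wedgeSq_comm u s, wedgeSq_of_orthogonal hsu, hws, hus]
    match_scalars
    all_goals field_simp
    all_goals ring
  -- Mathisson's vector measures the deviation of `j` from the solved field. That deviation is
  -- orthogonal to `s`, and to `u` under the parametrization condition, so double duality recovers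
  -- it from this image.
  have hM : mathissonVec m s u w j = star3 (solvedField m s Ψ w u - j) u s := by
    rw [mathissonVec_eq, star3_sub_left, hstar]; module
  rw [hM, ← hu0]
  constructor
  · rintro ⟨h, hju⟩
    have h5 := star3_star3 (solvedField m s Ψ w u - j) u s
    rw [h, show star3 0 u s = 0 by simpa using star3_smul_left 0 0 u s] at h5
    simp only [dot_sub_left, hju, hs0, hjs, wedgeSq_comm u s] at h5
    have h6 : wedgeSq s u • (solvedField m s Ψ w u - j) = 0 := by
      rw [h5]; module
    exact (sub_eq_zero.1 ((smul_eq_zero_iff_right hX).1 h6)).symm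
  · intro h
    rw [← h, sub_self]
    exact ⟨by simpa using star3_smul_left 0 0 u s, rfl⟩

theorem topField_eq_solvedField (m A : ℝ) (s : E) :
    topField m A s = solvedField m s (paramFun fun r => A * r ^ (4 / 3 : ℝ)) := by
  funext w u
  simp only [topField, solvedField, paramFun]
  match_scalars
  all_goals ring

end Constraint

/-! ### Differentiated constraint and equivalences along whole curves -/

section Curves

variable {m : ℝ} {s : E} {c : ℝ → E} {I : Set ℝ}

theorem Pirani.dot_eq_zero (hc : IsTimelikeCurve c I) (h : Pirani s c I) {t : ℝ} (ht : t ∈ I) :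
    dot s (iteratedDeriv 2 c t) = 0 ∧ dot s (iteratedDeriv 3 c t) = 0 := by
  have key : ∀ (v : ℝ → E), (∀ τ ∈ I, dot s (v τ) = 0) → ∀ τ ∈ I, ∀ v', HasDerivAt v v' τ →
      dot s v' = 0 := by
    intro v hv τ hτ v' hv'
    have h1 := (hasDerivAt_const τ s).dot hv'
    have h2 : (fun τ => dot s (v τ)) =ᶠ[𝓝 τ] fun _ => 0 := by
      filter_upwards [hc.isOpen.mem_nhds hτ] with σ hσ using hv σ hσ
    have h3 := h1.unique ((hasDerivAt_const τ (0 : ℝ)).congr_of_eventuallyEq h2)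
    simpa using h3
  have h2 : ∀ τ ∈ I, dot s (iteratedDeriv 2 c τ) = 0 := fun τ hτ =>
    key _ h τ hτ _ (hasDerivAt_deriv hc.isOpen hc.contDiffOn hτ)
  exact ⟨h2 t ht, key _ h2 t ht _ (hasDerivAt_iteratedDeriv_two hc.isOpen hc.contDiffOn ht)⟩

theorem isTopCurve_iff_isMathissonCurve (hs : dot s s < 0) (hc : IsTimelikeCurve c I)
    (h : Pirani s c I) : IsTopCurve m s c I ↔ IsMathissonCurve m s c I :=
  forall₂_congr fun t ht =>
    topVec_eq_zero_iff hs (hc.timelike t ht) (h t ht) (h.dot_eq_zero hc ht).1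

theorem isTopCurve_and_hasParam_iff (hs : dot s s < 0) (Ψ : E → E → ℝ)
    (hc : IsTimelikeCurve c I) (h : Pirani s c I) :
    (IsTopCurve m s c I ∧ HasParam Ψ c I) ↔ IsAutoparallel (solvedField m s Ψ) c I := by
  rw [isTopCurve_iff_isMathissonCurve hs hc h, IsMathissonCurve, HasParam, IsAutoparallel,
    ← forall₂_and]
  exact forall₂_congr fun t ht => mathissonVec_and_param_iff hs (hc.timelike t ht) (h t ht)
    (h.dot_eq_zero hc ht).1 (h.dot_eq_zero hc ht).2 Ψ

end Curves

/-! ### Reparametrization -/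

/-- Parameter invariance, with `l`, `a`, `b` standing for `φ'`, `φ''`, `φ'''`. Wedging with `u`
kills `b`; the terms in `a` cancel between the first two summands and within the mass term. -/
theorem topVec_reparam (m : ℝ) (s : E) {u : E} (w j : E) (hs : dot s s < 0) (hu : 0 < dot u u)
    {l : ℝ} (hl : l ≠ 0) (a b : ℝ) :
    topVec m s (l • u) (l ^ 2 • w + a • u) (l ^ 3 • j + (3 * l * a) • w + b • u) =
      |l| • topVec m s u w j := by
  have hX := (wedgeSq_neg hu hs).ne
  have hN := (wedgeNrm_pos hX).ne'
  have hn := (nrm_pos hu.ne').ne'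
  have hu' := hu.ne'
  have e1 : wedgeSq s (l • u) = l ^ 2 * wedgeSq s u := by
    simp only [wedgeSq_eq, dot_smul_left, dot_smul_right]; ring
  have e2 : wedgeNrm s (l • u) = |l| * wedgeNrm s u := by
    rw [wedgeNrm, e1, abs_mul, Real.sqrt_mul (abs_nonneg _), abs_pow, Real.sqrt_sq (abs_nonneg _),
      wedgeNrm]
  have e3 : nrm (l • u) = |l| * nrm u := by
    rw [nrm, dot_smul_left, dot_smul_right, ← mul_assoc, abs_mul, abs_mul,
      Real.sqrt_mul (by positivity), Real.sqrt_mul_self (abs_nonneg _), nrm]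
  have e4 : wedgeDot (l ^ 2 • w + a • u) s (l • u) s =
      l ^ 3 * wedgeDot w s u s + a * l * wedgeSq s u := by
    simp only [wedgeDot, wedgeSq_eq, dot_smul_left, dot_smul_right, dot_add_left, dot_comm u s]
    ring
  have h2 : |l| ^ 2 = l ^ 2 := sq_abs l
  have hl' : |l| ≠ 0 := abs_ne_zero.2 hl
  simp only [topVec, e1, e2, e3, e4, star3_add_left, star3_smul_left, star3_smul_second,
    star3_self_left, dot_add_left, dot_smul_left, dot_smul_right]
  generalize |l| = k at *
  match_scalars
  · field_simp; rw [h2]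
  · field_simp; rw [h2]; ring
  · field_simp; rw [h2]
  · field_simp; rw [h2]; ring

section Reparam

variable {c : ℝ → E} {I J : Set ℝ} {φ : ℝ → ℝ}

theorem deriv_comp_reparam (hI : IsOpen I) (hc : ContDiffOn ℝ 3 c I) (hJ : IsOpen J)
    (hφ : ContDiffOn ℝ 3 φ J) (hm : Set.MapsTo φ J I) {t : ℝ} (ht : t ∈ J) :
    deriv (c ∘ φ) t = deriv φ t • deriv c (φ t) :=
  ((hasDerivAt_of_contDiffOn hI hc (hm ht)).scomp t (hasDerivAt_of_contDiffOn hJ hφ ht)).deriv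

theorem iteratedDeriv_two_comp_reparam (hI : IsOpen I) (hc : ContDiffOn ℝ 3 c I) (hJ : IsOpen J)
    (hφ : ContDiffOn ℝ 3 φ J) (hm : Set.MapsTo φ J I) {t : ℝ} (ht : t ∈ J) :
    iteratedDeriv 2 (c ∘ φ) t =
      deriv φ t ^ 2 • iteratedDeriv 2 c (φ t) + iteratedDeriv 2 φ t • deriv c (φ t) := by
  rw [iteratedDeriv_succ, iteratedDeriv_one]
  have hev : deriv (c ∘ φ) =ᶠ[𝓝 t] fun τ => deriv φ τ • (deriv c ∘ φ) τ := by
    filter_upwards [hJ.mem_nhds ht] with τ hτ using deriv_comp_reparam hI hc hJ hφ hm hτ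
  rw [hev.deriv_eq, ((hasDerivAt_deriv hJ hφ ht).fun_smul ((hasDerivAt_deriv hI hc (hm ht)).scomp t
    (hasDerivAt_of_contDiffOn hJ hφ ht))).deriv, Function.comp]
  module

theorem iteratedDeriv_three_comp_reparam (hI : IsOpen I) (hc : ContDiffOn ℝ 3 c I) (hJ : IsOpen J)
    (hφ : ContDiffOn ℝ 3 φ J) (hm : Set.MapsTo φ J I) {t : ℝ} (ht : t ∈ J) :
    iteratedDeriv 3 (c ∘ φ) t =
      deriv φ t ^ 3 • iteratedDeriv 3 c (φ t)
        + (3 * deriv φ t * iteratedDeriv 2 φ t) • iteratedDeriv 2 c (φ t)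
        + iteratedDeriv 3 φ t • deriv c (φ t) := by
  rw [iteratedDeriv_succ (n := 2)]
  have hev : iteratedDeriv 2 (c ∘ φ) =ᶠ[𝓝 t] fun τ => deriv φ τ ^ 2 • (iteratedDeriv 2 c ∘ φ) τ
      + iteratedDeriv 2 φ τ • (deriv c ∘ φ) τ := by
    filter_upwards [hJ.mem_nhds ht] with τ hτ using
      iteratedDeriv_two_comp_reparam hI hc hJ hφ hm hτ
  have h0 := hasDerivAt_of_contDiffOn hJ hφ ht
  rw [hev.deriv_eq, ((((hasDerivAt_deriv hJ hφ ht).fun_pow 2).fun_smul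
    ((hasDerivAt_iteratedDeriv_two hI hc (hm ht)).scomp t h0)).fun_add
    ((hasDerivAt_iteratedDeriv_two hJ hφ ht).fun_smul
      ((hasDerivAt_deriv hI hc (hm ht)).scomp t h0))).deriv]
  simp only [Function.comp]
  match_scalars
  · ring
  · ring
  · ring

theorem IsTimelikeCurve.comp (hc : IsTimelikeCurve c I) (hJ : IsOpen J) (hJ' : J.OrdConnected)
    (hφ : ContDiffOn ℝ 3 φ J) (h0 : ∀ τ ∈ J, deriv φ τ ≠ 0) (hm : Set.MapsTo φ J I) :
    IsTimelikeCurve (c ∘ φ) J where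
  isOpen := hJ
  ordConnected := hJ'
  contDiffOn := hc.contDiffOn.comp hφ hm
  timelike t ht := by
    rw [deriv_comp_reparam hc.isOpen hc.contDiffOn hJ hφ hm ht, dot_smul_left, dot_smul_right]
    have := mul_self_pos.2 (h0 t ht)
    have := hc.timelike _ (hm ht)
    rw [← mul_assoc]
    positivity

theorem topVec_comp (m : ℝ) {s : E} (hs : dot s s < 0) (hc : IsTimelikeCurve c I) (hJ : IsOpen J)
    (hφ : ContDiffOn ℝ 3 φ J) (h0 : ∀ τ ∈ J, deriv φ τ ≠ 0) (hm : Set.MapsTo φ J I) {t : ℝ}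
    (ht : t ∈ J) :
    topVec m s (deriv (c ∘ φ) t) (iteratedDeriv 2 (c ∘ φ) t) (iteratedDeriv 3 (c ∘ φ) t) =
      |deriv φ t| • topVec m s (deriv c (φ t)) (iteratedDeriv 2 c (φ t))
        (iteratedDeriv 3 c (φ t)) := by
  rw [deriv_comp_reparam hc.isOpen hc.contDiffOn hJ hφ hm ht,
    iteratedDeriv_two_comp_reparam hc.isOpen hc.contDiffOn hJ hφ hm ht,
    iteratedDeriv_three_comp_reparam hc.isOpen hc.contDiffOn hJ hφ hm ht,
    topVec_reparam m s _ _ hs (hc.timelike _ (hm ht)) (h0 t ht)]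


end Reparam

/-! ### The commutation relations -/

theorem hasFDerivAt_velocity (p : E × E × E) : HasFDerivAt (fun q : E × E × E => q.2.1)
    ((ContinuousLinearMap.fst ℝ E E).comp (ContinuousLinearMap.snd ℝ E (E × E))) p :=
  ((ContinuousLinearMap.fst ℝ E E).comp (ContinuousLinearMap.snd ℝ E (E × E))).hasFDerivAt

theorem hasFDerivAt_acceleration (p : E × E × E) : HasFDerivAt (fun q : E × E × E => q.2.2)
    ((ContinuousLinearMap.snd ℝ E E).comp (ContinuousLinearMap.snd ℝ E (E × E))) p :=
  ((ContinuousLinearMap.snd ℝ E E).comp (ContinuousLinearMap.snd ℝ E (E × E))).hasFDerivAt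

theorem lieBracket_zeta1_spray {ξ : E → E → E} {p : E × E × E}
    (h : DifferentiableAt ℝ (fun q : E × E × E => ξ q.2.2 q.2.1) p) :
    VectorField.lieBracket ℝ zeta1 (spray ξ) p =
      (p.2.1, p.2.2, fderiv ℝ (fun q : E × E × E => ξ q.2.2 q.2.1) p (zeta1 p)
        - (2 : ℝ) • ξ p.2.2 p.2.1) := by
  have h1 : HasFDerivAt zeta1 _ p :=
    (hasFDerivAt_const (0 : E) p).prodMk ((hasFDerivAt_velocity p).prodMk
      ((hasFDerivAt_acceleration p).const_smul (2 : ℝ)))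
  have h2 : HasFDerivAt (spray ξ) _ p :=
    (hasFDerivAt_velocity p).prodMk ((hasFDerivAt_acceleration p).prodMk h.hasFDerivAt)
  rw [VectorField.lieBracket, h1.fderiv, h2.fderiv]
  simp [zeta1, spray, two_smul]

theorem lieBracket_zeta2_spray {ξ : E → E → E} {p : E × E × E}
    (h : DifferentiableAt ℝ (fun q : E × E × E => ξ q.2.2 q.2.1) p) :
    VectorField.lieBracket ℝ zeta2 (spray ξ) p =
      (0, p.2.1, fderiv ℝ (fun q : E × E × E => ξ q.2.2 q.2.1) p (zeta2 p) - p.2.2) := by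
  have h1 : HasFDerivAt zeta2 _ p :=
    (hasFDerivAt_const (0 : E) p).prodMk ((hasFDerivAt_const (0 : E) p).prodMk
      (hasFDerivAt_velocity p))
  have h2 : HasFDerivAt (spray ξ) _ p :=
    (hasFDerivAt_velocity p).prodMk ((hasFDerivAt_acceleration p).prodMk h.hasFDerivAt)
  rw [VectorField.lieBracket, h1.fderiv, h2.fderiv]
  simp [zeta2, spray]

/-- The first two components of both brackets agree automatically; the third ones say how `ξ`
changes along the Liouville fields. -/
theorem isAutoparallelField_iff (ξ : E → E → E) :
    IsAutoparallelField ξ 0 0 ↔ ∀ p : E × E × E, 0 < dot p.2.1 p.2.1 →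
      DifferentiableAt ℝ (fun q : E × E × E => ξ q.2.2 q.2.1) p ∧
      fderiv ℝ (fun q : E × E × E => ξ q.2.2 q.2.1) p (zeta1 p) = (3 : ℝ) • ξ p.2.2 p.2.1 ∧
      fderiv ℝ (fun q : E × E × E => ξ q.2.2 q.2.1) p (zeta2 p) = (3 : ℝ) • p.2.2 := by
  refine forall₂_congr fun p _ => ?_
  have hd : DifferentiableAt ℝ (spray ξ) p ↔
      DifferentiableAt ℝ (fun q : E × E × E => ξ q.2.2 q.2.1) p :=
    ⟨fun h => h.snd.snd, fun h =>
      (differentiableAt_snd.fst).prodMk ((differentiableAt_snd.snd).prodMk h)⟩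
  rw [hd]
  refine and_congr_right fun h => ?_
  rw [lieBracket_zeta1_spray h, lieBracket_zeta2_spray h]
  simp only [spray, zeta1, zeta2, mul_zero, zero_smul, sub_zero, Prod.mk.injEq, true_and,
    sub_eq_iff_eq_add]
  have e1 : ∀ a : E, a + (2 : ℝ) • a = (3 : ℝ) • a := fun a => by module
  have e2 : ∀ a : E, (2 : ℝ) • a + a = (3 : ℝ) • a := fun a => by module
  rw [e1, e2]

/-! ### Integration along the Liouville fields and the exponent `4/3` -/

theorem hasDerivAt_dilation (p : E × E × E) (r : ℝ) :
    HasDerivAt (fun r : ℝ => ((p.1, Real.exp r • p.2.1, Real.exp (2 * r) • p.2.2) : E × E × E))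
      (zeta1 (p.1, Real.exp r • p.2.1, Real.exp (2 * r) • p.2.2)) r := by
  refine (hasDerivAt_const r p.1).prodMk (((Real.hasDerivAt_exp r).smul_const p.2.1).prodMk ?_)
  have h := (((hasDerivAt_id r).const_mul (2 : ℝ)).exp).smul_const p.2.2
  refine h.congr_deriv ?_
  simp only [id]
  module

theorem hasDerivAt_acceleration_shift (p : E × E × E) :
    HasDerivAt (fun r : ℝ => ((p.1, p.2.1, p.2.2 + r • p.2.1) : E × E × E)) (zeta2 p) 0 := by
  refine (hasDerivAt_const _ p.1).prodMk ((hasDerivAt_const _ p.2.1).prodMk ?_)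
  simpa using ((hasDerivAt_id (0 : ℝ)).smul_const p.2.1).const_add p.2.2

/-- Along the flow of `ζ¹` the relation reads `dξ/dr = 3 ξ`, hence `e⁻³ʳ ξ` is constant. -/
theorem IsAutoparallelField.dilation {ξ : E → E → E} (h : IsAutoparallelField ξ 0 0) {u : E}
    (hu : 0 < dot u u) (w : E) (r : ℝ) :
    ξ (Real.exp (2 * r) • w) (Real.exp r • u) = Real.exp (3 * r) • ξ w u := by
  rw [isAutoparallelField_iff] at h
  set y : ℝ → E := fun r =>
    Real.exp (-(3 * r)) • ξ (Real.exp (2 * r) • w) (Real.exp r • u) with hy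
  have hd : ∀ r, HasDerivAt y 0 r := by
    intro r
    have hpos : 0 < dot (Real.exp r • u) (Real.exp r • u) := by
      rw [dot_smul_left, dot_smul_right]; positivity
    obtain ⟨h1, h2, -⟩ := h (0, Real.exp r • u, Real.exp (2 * r) • w) hpos
    have h3 := HasFDerivAt.comp_hasDerivAt r h1.hasFDerivAt (hasDerivAt_dilation (0, u, w) r)
    rw [h2] at h3
    have h4 := (((hasDerivAt_id r).const_mul (3 : ℝ)).neg.exp).smul h3
    refine h4.congr_deriv ?_
    simp only [id, Function.comp, Pi.neg_apply]
    module
  have h0 := is_const_of_deriv_eq_zero (fun r => (hd r).differentiableAt)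
    (fun r => (hd r).deriv) r 0
  simp only [hy, mul_zero, neg_zero, Real.exp_zero, one_smul] at h0
  rw [← h0, smul_smul, ← Real.exp_add]
  simp

theorem dot_solvedField_velocity (m : ℝ) (s : E) (Ψ : E → E → ℝ) (w : E) {u : E}
    (hu : dot u u ≠ 0) : dot (solvedField m s Ψ w u) u = dot u u * Ψ w u := by
  simp only [solvedField, dot_add_left, dot_sub_left, dot_smul_left, dot_star3_second]
  field_simp
  ring

theorem wedgeNrm_smul_smul (a b : ℝ) (w u : E) :
    wedgeNrm (a • w) (b • u) = |a * b| * wedgeNrm w u := by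
  have : wedgeSq (a • w) (b • u) = (a * b) ^ 2 * wedgeSq w u := by
    simp only [wedgeSq_eq, dot_smul_left, dot_smul_right]; ring
  rw [wedgeNrm, this, abs_mul, Real.sqrt_mul (abs_nonneg _), abs_pow, Real.sqrt_sq (abs_nonneg _),
    wedgeNrm]

/-- Pairing the homogeneity of the field with `u` isolates `Ψ`, and `‖u̇ ∧ u‖` has weight `3` while
`f` must have weight `4`. The relation with `ζ¹` alone suffices here. -/
theorem eq_rpow_of_isAutoparallelField {m : ℝ} {s : E} {f : ℝ → ℝ}
    (h : IsAutoparallelField (solvedField m s (paramFun f)) 0 0) {r : ℝ} (hr : 0 ≤ r) :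
    f r = f 1 * r ^ (4 / 3 : ℝ) := by
  have key : ∀ (u w : E) (r : ℝ), 0 < dot u u →
      f (Real.exp (3 * r) * wedgeNrm w u) = Real.exp (4 * r) * f (wedgeNrm w u) := by
    intro u w r hu
    have hpos : 0 < dot (Real.exp r • u) (Real.exp r • u) := by
      rw [dot_smul_left, dot_smul_right]; positivity
    have h1 := congrArg (fun v => dot v (Real.exp r • u)) (h.dilation hu w r)
    simp only [dot_solvedField_velocity m s _ _ hpos.ne'] at h1
    rw [dot_smul_left (Real.exp (3 * r)),
      dot_smul_right (Real.exp r) (solvedField m s (paramFun f) w u) u,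
      dot_solvedField_velocity m s _ _ hu.ne', paramFun, paramFun, wedgeNrm_smul_smul,
      ← Real.exp_add, Real.abs_exp, show 2 * r + r = 3 * r by ring] at h1
    have e2 : Real.exp (2 * r) = Real.exp r ^ 2 := by rw [← Real.exp_nat_mul]; norm_num
    have e3 : Real.exp (3 * r) = Real.exp r ^ 3 := by rw [← Real.exp_nat_mul]; norm_num
    have e4 : Real.exp (4 * r) = Real.exp r ^ 4 := by rw [← Real.exp_nat_mul]; norm_num
    have hu' := hu.ne'
    simp only [dot_smul_left, dot_smul_right, e2] at h1
    rw [e4]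
    generalize f (Real.exp (3 * r) * wedgeNrm w u) = F at *
    rw [e3] at h1
    have hE := (Real.exp_pos r).ne'
    generalize Real.exp r = l at *
    field_simp at h1
    linarith
  rcases hr.eq_or_lt with rfl | hr
  · have h0 := key (Pi.single 0 1) 0 1 (by simp [dot_expand])
    have hz : wedgeNrm 0 (Pi.single 0 1) = 0 := by simp [wedgeNrm, wedgeSq_eq]
    rw [hz, mul_zero] at h0
    have : Real.exp (4 * 1) ≠ 1 := by simp
    have h1 : (Real.exp (4 * 1) - 1) * f 0 = 0 := by linarith
    rw [Real.zero_rpow (by norm_num), mul_zero]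
    exact (mul_eq_zero.1 h1).resolve_left (sub_ne_zero.2 this)
  -- Orthonormal `u` and `u̇` have `‖u̇ ∧ u‖ = 1`, and the dilation by `log r / 3` scales this to
  -- `r`.
  · have h0 := key (Pi.single 0 1) (Pi.single 1 1) (Real.log r / 3) (by simp [dot_expand])
    have hz : wedgeNrm (Pi.single 1 1) (Pi.single 0 1) = 1 := by
      simp [wedgeNrm, wedgeSq_eq, dot_expand]
    rw [hz, mul_one, mul_div_cancel₀ _ (by norm_num), Real.exp_log hr] at h0
    rw [h0, Real.rpow_def_of_pos hr, mul_comm]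
    ring_nf

/-! ### Differentiability of the field -/

theorem wedgeNrm_nonneg (a b : E) : 0 ≤ wedgeNrm a b := Real.sqrt_nonneg _

theorem abs_dot_le (a b : E) : |dot a b| ≤ 4 * (‖a‖ * ‖b‖) := by
  have key : ∀ i, |a i * b i| ≤ ‖a‖ * ‖b‖ := fun i => by
    rw [abs_mul]
    exact mul_le_mul (norm_le_pi_norm a i) (norm_le_pi_norm b i) (abs_nonneg _) (norm_nonneg _)
  have h := fun i => abs_le.1 (key i)
  rw [dot_expand, abs_le]
  constructor <;> linarith [(h 0).1, (h 1).1, (h 2).1, (h 3).1, (h 0).2, (h 1).2, (h 2).2, (h 3).2]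

theorem wedgeNrm_le (a b : E) : wedgeNrm a b ≤ 6 * (‖a‖ * ‖b‖) := by
  refine Real.sqrt_le_iff.2 ⟨by positivity, ?_⟩
  have h1 := abs_dot_le a a
  have h2 := abs_dot_le b b
  have h3 := abs_dot_le a b
  have h4 : |dot a a * dot b b| ≤ (4 * (‖a‖ * ‖a‖)) * (4 * (‖b‖ * ‖b‖)) := by
    rw [abs_mul]; exact mul_le_mul h1 h2 (abs_nonneg _) (by positivity)
  have h5 : |dot a b ^ 2| ≤ (4 * (‖a‖ * ‖b‖)) ^ 2 := by
    rw [abs_pow]; exact pow_le_pow_left₀ (abs_nonneg _) h3 2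
  rw [wedgeSq_eq]
  refine (abs_sub _ _).trans ?_
  -- The two summands are at most `16 ‖a‖² ‖b‖²` each, and `32 ≤ 6²`.
  nlinarith [sq_nonneg (‖a‖ * ‖b‖)]

theorem wedgeSq_sub_smul (w u : E) (k : ℝ) : wedgeSq (w - k • u) u = wedgeSq w u := by
  simp only [wedgeSq_eq, dot_sub_left, dot_sub_right, dot_smul_left, dot_smul_right, dot_comm u w]
  ring

theorem eq_smul_of_wedgeSq_eq_zero {w u : E} (hu : 0 < dot u u) (h : wedgeSq w u = 0) :
    ∃ k : ℝ, w = k • u := by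
  refine ⟨dot w u / dot u u, ?_⟩
  have h1 := (dot_self_nonpos_of_orthogonal (v := w - (dot w u / dot u u) • u) hu
    (by simp; field_simp; ring)).2 ?_
  · exact sub_eq_zero.1 h1
  · have h2 : dot (w - (dot w u / dot u u) • u) (w - (dot w u / dot u u) • u)
        = wedgeSq w u / dot u u := by
      simp only [wedgeSq_eq, dot_sub_left, dot_sub_right, dot_smul_left, dot_smul_right,
        dot_comm u w]
      field_simp
      ring
    rw [h2, h, zero_div]

theorem differentiableAt_dot {V : Type*} [NormedAddCommGroup V] [NormedSpace ℝ V] {f g : V → E}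
    {p : V} (hf : DifferentiableAt ℝ f p) (hg : DifferentiableAt ℝ g p) :
    DifferentiableAt ℝ (fun q => dot (f q) (g q)) p :=
  DifferentiableAt.comp (g := fun p : E × E => dot p.1 p.2) p
    ((contDiff_dot.differentiable (by simp)) (f p, g p)) (hf.prodMk hg)

/-- The delicate points are those with `u̇ = k u`. Replacing `u̇` by `u̇ - k u` leaves the wedge
unchanged, so its norm is `O(‖q - p‖)` and the power `4/3` is `o(‖q - p‖)`: the derivative there is
zero. -/
theorem differentiableAt_wedgeNrm_rpow {p : E × E × E} (hu : 0 < dot p.2.1 p.2.1) :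
    DifferentiableAt ℝ (fun q : E × E × E => wedgeNrm q.2.2 q.2.1 ^ (4 / 3 : ℝ)) p := by
  have hX : DifferentiableAt ℝ (fun q : E × E × E => wedgeSq q.2.2 q.2.1) p := by
    simp only [wedgeSq_eq]
    have h1 := differentiableAt_dot (differentiableAt_snd.snd : DifferentiableAt ℝ _ p)
      (differentiableAt_snd.snd : DifferentiableAt ℝ _ p)
    have h2 := differentiableAt_dot (differentiableAt_snd.fst : DifferentiableAt ℝ _ p)
      (differentiableAt_snd.fst : DifferentiableAt ℝ _ p)
    have h3 := differentiableAt_dot (differentiableAt_snd.snd : DifferentiableAt ℝ _ p)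
      (differentiableAt_snd.fst : DifferentiableAt ℝ _ p)
    exact (h1.mul h2).sub (h3.pow 2)
  by_cases h : wedgeSq p.2.2 p.2.1 = 0
  · obtain ⟨k, hk⟩ := eq_smul_of_wedgeSq_eq_zero hu h
    have hO : (fun q : E × E × E => wedgeNrm q.2.2 q.2.1) =O[𝓝 p] fun q => ‖q - p‖ := by
      refine Asymptotics.IsBigO.of_bound (6 * ((1 + |k|) * (‖p.2.1‖ + 1))) ?_
      have hb : ∀ᶠ q : E × E × E in 𝓝 p, ‖q.2.1‖ < ‖p.2.1‖ + 1 :=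
        (continuous_snd.fst.norm.continuousAt).eventually_lt continuousAt_const (by simp)
      filter_upwards [hb] with q hq
      have e : wedgeNrm q.2.2 q.2.1 = wedgeNrm (q.2.2 - k • q.2.1) q.2.1 := by
        rw [wedgeNrm, wedgeNrm, wedgeSq_sub_smul]
      have hz : ‖q.2.2 - k • q.2.1‖ ≤ (1 + |k|) * ‖q - p‖ := by
        have e1 : q.2.2 - k • q.2.1 = (q - p).2.2 - k • (q - p).2.1 := by
          simp only [Prod.snd_sub, Prod.fst_sub, hk]; module
        have n1 : ‖(q - p).2.2‖ ≤ ‖q - p‖ := (norm_snd_le _).trans (norm_snd_le _)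
        have n2 : ‖(q - p).2.1‖ ≤ ‖q - p‖ := (norm_fst_le _).trans (norm_snd_le _)
        rw [e1]
        refine (norm_sub_le _ _).trans ?_
        rw [norm_smul, Real.norm_eq_abs]
        nlinarith [mul_le_mul_of_nonneg_left n2 (abs_nonneg k)]
      rw [Real.norm_of_nonneg (wedgeNrm_nonneg _ _), norm_norm, e]
      refine (wedgeNrm_le _ _).trans ?_
      rw [mul_assoc 6, mul_right_comm (1 + |k|)]
      gcongr
    have hO' := hO.rpow (r := 4 / 3) (by norm_num) (Eventually.of_forall fun q => norm_nonneg _)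
    have ho : (fun q : E × E × E => ‖q - p‖ ^ (4 / 3 : ℝ)) =o[𝓝 p] fun q => q - p := by
      have ht : Tendsto (fun q : E × E × E => ‖q - p‖ ^ (1 / 3 : ℝ)) (𝓝 p) (𝓝 0) := by
        have : ContinuousAt (fun q : E × E × E => ‖q - p‖ ^ (1 / 3 : ℝ)) p := by
          refine ContinuousAt.rpow_const (by fun_prop) (Or.inr (by norm_num))
        simpa [ContinuousAt] using this
      have h1 := ((Asymptotics.isLittleO_one_iff ℝ).2 ht).mul_isBigO
        (Asymptotics.isBigO_refl (fun q : E × E × E => ‖q - p‖) (𝓝 p))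
      simp only [one_mul] at h1
      refine (h1.congr_left fun q => ?_).of_norm_right
      rw [← Real.rpow_add_one' (norm_nonneg _) (by norm_num)]
      norm_num
    have hw0 : wedgeNrm p.2.2 p.2.1 = 0 := by simp [wedgeNrm, h]
    refine HasFDerivAt.differentiableAt (f' := 0) (hasFDerivAt_iff_isLittleO.2 ?_)
    simpa [hw0] using hO'.trans_isLittleO ho
  · refine DifferentiableAt.rpow_const ?_ (Or.inl (wedgeNrm_pos h).ne')
    exact (hX.abs h).sqrt (abs_ne_zero.2 h)

theorem differentiable_star3_left (s : E) :
    Differentiable ℝ fun q : E × E × E => star3 q.2.2 q.2.1 s := by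
  rw [differentiable_pi]
  intro i
  simp only [star3, vol_expand]
  fun_prop

theorem differentiableAt_topField (m A : ℝ) {s : E} (hs : dot s s < 0) {p : E × E × E}
    (hu : 0 < dot p.2.1 p.2.1) :
    DifferentiableAt ℝ (fun q : E × E × E => topField m A s q.2.2 q.2.1) p := by
  have hfu : DifferentiableAt ℝ (fun q : E × E × E => q.2.1) p := differentiableAt_snd.fst
  have hfw : DifferentiableAt ℝ (fun q : E × E × E => q.2.2) p := differentiableAt_snd.snd
  have h1 := differentiableAt_dot hfw hfu
  have h2 := differentiableAt_dot hfu hfu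
  have h3 := differentiableAt_dot hfw hfw
  have h4 := differentiableAt_wedgeNrm_rpow hu
  have h5 := differentiable_star3_left s p
  have h6 : DifferentiableAt ℝ (fun q : E × E × E => wedgeNrm q.2.1 s) p := by
    simp only [wedgeNrm_comm _ s]
    exact DifferentiableAt.comp (g := wedgeNrm s) p
      (hasFDerivAt_wedgeNrm (wedgeSq_neg hu hs)).differentiableAt hfu
  have h7 : DifferentiableAt ℝ (fun q : E × E × E => nrm q.2.1) p :=
    DifferentiableAt.comp (g := nrm) p (hasFDerivAt_nrm hu).differentiableAt hfu
  have n1 := hu.ne'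
  have n2 : dot p.2.1 p.2.1 ^ 2 ≠ 0 := pow_ne_zero _ n1
  have n3 : dot s s * nrm s * nrm p.2.1 ≠ 0 :=
    mul_ne_zero (mul_ne_zero hs.ne (nrm_pos hs.ne).ne') (nrm_pos n1).ne'
  unfold topField
  fun_prop (disch := assumption)

/-! ### Behaviour of the explicit field under the flows of the Liouville fields -/

theorem topField_dilation (m A : ℝ) (s w u : E) (r : ℝ) :
    topField m A s (Real.exp (2 * r) • w) (Real.exp r • u) =
      Real.exp (3 * r) • topField m A s w u := by
  have e2 : Real.exp (2 * r) = Real.exp r ^ 2 := by rw [← Real.exp_nat_mul]; norm_num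
  have e3 : Real.exp (3 * r) = Real.exp r ^ 3 := by rw [← Real.exp_nat_mul]; norm_num
  have hE := Real.exp_pos r
  have e4 : wedgeNrm (Real.exp (2 * r) • w) (Real.exp r • u) ^ (4 / 3 : ℝ) =
      Real.exp r ^ 4 * wedgeNrm w u ^ (4 / 3 : ℝ) := by
    rw [wedgeNrm_smul_smul, ← Real.exp_add, Real.abs_exp,
      Real.mul_rpow (Real.exp_pos _).le (wedgeNrm_nonneg _ _), ← Real.exp_mul, ← Real.exp_nat_mul]
    congr 2
    push_cast
    ring
  have e5 : wedgeNrm (Real.exp r • u) s = Real.exp r * wedgeNrm u s := by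
    simpa using wedgeNrm_smul_smul (Real.exp r) 1 u s
  have e6 : nrm (Real.exp r • u) = Real.exp r * nrm u := by
    rw [nrm, dot_smul_left, dot_smul_right, ← mul_assoc, abs_mul, Real.sqrt_mul (abs_nonneg _),
      abs_mul_self, Real.sqrt_mul_self hE.le, nrm]
  rw [topField, e4]
  simp only [topField, e5, e6, e2, e3, dot_smul_left, dot_smul_right, star3_smul_left,
    star3_smul_second]
  generalize Real.exp r = l at *
  match_scalars
  all_goals field_simp

/-- The term `½ ‖u̇‖²` in the parametrization is what cancels the part along `u` that is linear in
`r`: its coefficients add up to `3 - 6 + 3 = 0`. -/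
theorem topField_acceleration_shift (m A : ℝ) (s w : E) {u : E} (hu : dot u u ≠ 0) (r : ℝ) :
    topField m A s (w + r • u) u =
      topField m A s w u + (3 * r) • w + (3 / 2 * r ^ 2) • u := by
  have e1 : wedgeNrm (w + r • u) u = wedgeNrm w u := by
    rw [wedgeNrm, wedgeNrm, ← wedgeSq_sub_smul w u (-r), neg_smul, sub_neg_eq_add]
  simp only [topField, e1, star3_add_left, star3_smul_left, star3_self_left, dot_add_left,
    dot_add_right, dot_smul_left, dot_smul_right, dot_comm u w]
  match_scalars
  all_goals field_simp
  all_goals ring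

theorem isAutoparallelField_topField (m A : ℝ) {s : E} (hs : dot s s < 0) :
    IsAutoparallelField (topField m A s) 0 0 := by
  rw [isAutoparallelField_iff]
  intro p hu
  have hd := differentiableAt_topField m A hs hu
  refine ⟨hd, ?_, ?_⟩
  · have h1 := hasDerivAt_dilation p 0
    simp only [mul_zero, Real.exp_zero, one_smul] at h1
    have h2 := HasFDerivAt.comp_hasDerivAt_of_eq (0 : ℝ) hd.hasFDerivAt h1 (by simp)
    have h3 : HasDerivAt (fun r : ℝ => Real.exp (3 * r) • topField m A s p.2.2 p.2.1)
        ((3 : ℝ) • topField m A s p.2.2 p.2.1) 0 := by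
      simpa using (((hasDerivAt_id (0 : ℝ)).const_mul (3 : ℝ)).exp).smul_const
        (topField m A s p.2.2 p.2.1)
    refine h2.unique (h3.congr_of_eventuallyEq (Eventually.of_forall fun r => ?_))
    exact topField_dilation m A s p.2.2 p.2.1 r
  · have h2 := HasFDerivAt.comp_hasDerivAt_of_eq (0 : ℝ) hd.hasFDerivAt
      (hasDerivAt_acceleration_shift p) (by simp)
    have h3 : HasDerivAt (fun r : ℝ => topField m A s p.2.2 p.2.1 + (3 * r) • p.2.2
        + (3 / 2 * r ^ 2) • p.2.1) ((3 : ℝ) • p.2.2) 0 := by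
      simpa using ((((hasDerivAt_id (0 : ℝ)).const_mul (3 : ℝ)).smul_const p.2.2).const_add
        (topField m A s p.2.2 p.2.1)).fun_add
        ((((hasDerivAt_id (0 : ℝ)).pow 2).const_mul (3 / 2 : ℝ)).smul_const p.2.1)
    refine h2.unique (h3.congr_of_eventuallyEq (Eventually.of_forall fun r => ?_))
    exact topField_acceleration_shift m A s p.2.2 hu.ne' r

theorem isAutoparallelField_solvedField_iff (m : ℝ) {s : E} (hs : dot s s < 0) (f : ℝ → ℝ) :
    IsAutoparallelField (solvedField m s (paramFun f)) 0 0 ↔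
      ∃ A : ℝ, ∀ r : ℝ, 0 ≤ r → f r = A * r ^ (4 / 3 : ℝ) := by
  constructor
  · exact fun h => ⟨f 1, fun r hr => eq_rpow_of_isAutoparallelField h hr⟩
  · rintro ⟨A, hA⟩
    have h : paramFun f = paramFun fun r => A * r ^ (4 / 3 : ℝ) := by
      funext w u
      rw [paramFun, paramFun, hA _ (wedgeNrm_nonneg _ _)]
    rw [h, ← topField_eq_solvedField]
    exact isAutoparallelField_topField m A hs


/-! ### Existence of the distinguished parametrizations -/

/-- Picard–Lindelöf for `y'' = k y` as a first-order system, started at `y = 1`, `y' = 0` so that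
`y` stays positive nearby. -/
theorem exists_local_solution_linear {I : Set ℝ} {k : ℝ → ℝ} {t₀ : ℝ} (hI : I ∈ 𝓝 t₀)
    (hk : ContinuousOn k I) :
    ∃ U ∈ 𝓝 t₀, IsOpen U ∧ U ⊆ I ∧ ∃ y z : ℝ → ℝ, ∀ t ∈ U,
      0 < y t ∧ HasDerivAt y (z t) t ∧ HasDerivAt z (k t * y t) t := by
  obtain ⟨δ, hδ, hδI⟩ := Metric.nhds_basis_closedBall.mem_iff.1 hI
  rw [Real.closedBall_eq_Icc] at hδI
  obtain ⟨M, hM⟩ := isCompact_Icc.exists_bound_of_continuousOn (hk.mono hδI)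
  obtain ⟨N, hN⟩ : ∃ N : NNReal, (N : ℝ) = |M| + 1 := ⟨⟨|M| + 1, by positivity⟩, rfl⟩
  have hN1 : (1 : ℝ) ≤ N := by simp [hN]
  have hkN : ∀ t ∈ Set.Icc (t₀ - δ) (t₀ + δ), |k t| ≤ N := fun t ht =>
    (hM t ht).trans ((le_abs_self M).trans (by simp [hN]))
  set ε : ℝ := min δ (1 / (2 * N))
  have hε0 : 0 < ε := lt_min hδ (by positivity)
  have hsub : Set.Icc (t₀ - ε) (t₀ + ε) ⊆ Set.Icc (t₀ - δ) (t₀ + δ) := by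
    have : ε ≤ δ := min_le_left _ _
    exact Set.Icc_subset_Icc (by linarith) (by linarith)
  have hb : ∀ t ∈ Set.Icc (t₀ - δ) (t₀ + δ), ∀ p : ℝ × ℝ, ‖(p.2, k t * p.1)‖ ≤ N * ‖p‖ := by
    intro t ht p
    refine norm_prod_le_iff.2 ⟨?_, ?_⟩
    · exact (norm_snd_le p).trans (le_mul_of_one_le_left (norm_nonneg _) hN1)
    · rw [norm_mul]
      exact mul_le_mul (hkN t ht) (norm_fst_le p) (norm_nonneg _) N.2
  -- On the unit ball about `(1, 0)` the norm is at most `2`, so the field is bounded by `2 N`; the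
  -- time `ε ≤ 1 / (2 N)` keeps solutions in that ball.
  have hPL : IsPicardLindelof (fun t (p : ℝ × ℝ) => (p.2, k t * p.1)) (tmin := t₀ - ε)
      (tmax := t₀ + ε) ⟨t₀, by simp [hε0.le]⟩ ((1 : ℝ), (0 : ℝ)) 1 0 (2 * N) N := by
    refine ⟨fun t ht => ?_, fun p _ => ?_, fun t ht p hp => ?_, ?_⟩
    · refine LipschitzWith.lipschitzOnWith (LipschitzWith.of_dist_le_mul fun p q => ?_)
      rw [dist_eq_norm, dist_eq_norm]
      simpa only [Prod.fst_sub, Prod.snd_sub, mul_sub, Prod.mk_sub_mk] using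
        hb t (hsub ht) (p - q)
    · exact continuousOn_const.prodMk ((hk.mono (hsub.trans hδI)).mul continuousOn_const)
    · refine (hb t (hsub ht) p).trans ?_
      have h1 : ‖p‖ ≤ 2 := by
        have h2 := norm_le_norm_add_norm_sub' p ((1 : ℝ), (0 : ℝ))
        have h3 : ‖((1 : ℝ), (0 : ℝ))‖ = 1 := by simp [Prod.norm_def]
        rw [mem_closedBall_iff_norm] at hp
        have h4 : ((1 : NNReal) : ℝ) = 1 := NNReal.coe_one
        linarith
      push_cast
      nlinarith [N.2]
    · have h1 : ε ≤ 1 / (2 * N) := min_le_right _ _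
      have h2 : (0 : ℝ) < 2 * N := by positivity
      rw [le_div_iff₀ h2] at h1
      simp only [add_sub_cancel_left, sub_sub_cancel, max_self]
      push_cast
      linarith
  obtain ⟨α, hα0, hα⟩ := hPL.exists_eq_forall_mem_Icc_hasDerivWithinAt₀
  have hα' : ∀ t ∈ Set.Ioo (t₀ - ε) (t₀ + ε), HasDerivAt α ((α t).2, k t * (α t).1) t :=
    fun t ht => (hα t (Set.Ioo_subset_Icc_self ht)).hasDerivAt (Icc_mem_nhds ht.1 ht.2)
  have ht₀ : t₀ ∈ Set.Ioo (t₀ - ε) (t₀ + ε) := by constructor <;> linarith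
  have hpos : ∀ᶠ t in 𝓝 t₀, 0 < (α t).1 :=
    continuousAt_const.eventually_lt (hα' t₀ ht₀).continuousAt.fst (by
      simp only at hα0
      simp [hα0])
  obtain ⟨V, hV, hVo, htV⟩ := eventually_nhds_iff.1 hpos
  refine ⟨Set.Ioo (t₀ - ε) (t₀ + ε) ∩ V, (isOpen_Ioo.inter hVo).mem_nhds ⟨ht₀, htV⟩,
    isOpen_Ioo.inter hVo, fun t ht => hδI (hsub (Set.Ioo_subset_Icc_self ht.1)),
    fun t => (α t).1, fun t => (α t).2, fun t ht => ⟨hV t ht.2, ?_, ?_⟩⟩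
  · exact (hasFDerivAt_fst (p := α t)).comp_hasDerivAt t (hα' t ht.1)
  · exact (hasFDerivAt_snd (p := α t)).comp_hasDerivAt t (hα' t ht.1)

/-- Near every point there is a change of parameter with prescribed Schwarzian derivative. -/
theorem exists_reparam_schwarzian {I : Set ℝ} {K : ℝ → ℝ} {t₀ : ℝ} (hI : I ∈ 𝓝 t₀)
    (hK : ContinuousOn K I) :
    ∃ (J : Set ℝ) (φ : ℝ → ℝ), IsOpen J ∧ J.OrdConnected ∧ ContDiffOn ℝ 3 φ J ∧
      Set.MapsTo φ J I ∧ t₀ ∈ φ '' J ∧ ∀ τ ∈ J, 0 < deriv φ τ ∧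
        deriv φ τ * iteratedDeriv 3 φ τ =
          3 / 2 * iteratedDeriv 2 φ τ ^ 2 + deriv φ τ ^ 4 * K (φ τ) := by
  -- With `y'' = (K/2) y`, any `φ` satisfying `φ' = y(φ)²` has `φ'' = 2 y³ y'` and `φ''' = 6 y⁴ y'²
  -- + y⁶ K`, whence the required equation.
  obtain ⟨U, hU, hUo, hUI, y, z, hyz⟩ := exists_local_solution_linear hI (hK.div_const 2)
  have hy1 : ContDiffOn ℝ 1 y U := by
    refine (contDiffOn_succ_iff_deriv_of_isOpen (n := 0) hUo).2
      ⟨fun t ht => (hyz t ht).2.1.differentiableAt.differentiableWithinAt, by simp, ?_⟩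
    refine contDiffOn_zero.2 (ContinuousOn.congr (f := z) (fun t ht =>
      (hyz t ht).2.2.continuousAt.continuousWithinAt) fun t ht => (hyz t ht).2.1.deriv)
  have hz1 : ContDiffOn ℝ 1 z U := by
    refine (contDiffOn_succ_iff_deriv_of_isOpen (n := 0) hUo).2
      ⟨fun t ht => (hyz t ht).2.2.differentiableAt.differentiableWithinAt, by simp, ?_⟩
    refine contDiffOn_zero.2 (ContinuousOn.congr (f := fun t => K t / 2 * y t)
      (((hK.mono hUI).div_const 2).mul hy1.continuousOn) fun t ht => (hyz t ht).2.2.deriv)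
  have hy2 : ContDiffOn ℝ 2 y U := by
    refine (contDiffOn_succ_iff_deriv_of_isOpen (n := 1) hUo).2
      ⟨hy1.differentiableOn (by simp), by simp, hz1.congr fun t ht => (hyz t ht).2.1.deriv⟩
  have hyA : ContDiffAt ℝ 1 (fun t => y t ^ 2) t₀ := (hy1.contDiffAt hU).pow 2
  obtain ⟨φ, hφ0, ε, hε, hφ⟩ :=
    hyA.exists_forall_mem_closedBall_exists_eq_forall_mem_Ioo_hasDerivAt₀ t₀
  have ht₀ : t₀ ∈ Set.Ioo (t₀ - ε) (t₀ + ε) := by constructor <;> linarith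
  have hev : ∀ᶠ t in 𝓝 t₀, t ∈ Set.Ioo (t₀ - ε) (t₀ + ε) ∧ φ t ∈ U :=
    (isOpen_Ioo.eventually_mem ht₀).and
      ((hφ t₀ ht₀).continuousAt.eventually_mem (by rwa [hφ0]))
  obtain ⟨δ, hδ, hδJ⟩ := Metric.eventually_nhds_iff_ball.1 hev
  set J := Metric.ball t₀ δ with hJ
  have hJo : IsOpen J := Metric.isOpen_ball
  have hmU : Set.MapsTo φ J U := fun t ht => (hδJ t ht).2
  have hd1 : ∀ t ∈ J, HasDerivAt φ (y (φ t) ^ 2) t := fun t ht => hφ t (hδJ t ht).1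
  have hφd : DifferentiableOn ℝ φ J := fun t ht =>
    (hd1 t ht).differentiableAt.differentiableWithinAt
  -- Bootstrap: `φ' = y(φ)²` with `y` of class `C²` gains one derivative at a time, up to `C³`.
  have hstep : ∀ n : ℕ, n ≤ 2 → ContDiffOn ℝ n φ J → ContDiffOn ℝ (n + 1 : ℕ) φ J := by
    intro n hn h
    have h2 : (n : WithTop ℕ∞) ≤ 2 := by exact_mod_cast hn
    push_cast
    refine (contDiffOn_succ_iff_deriv_of_isOpen hJo).2 ⟨hφd, by simp, ?_⟩
    exact (((hy2.of_le h2).comp h hmU).pow 2).congr fun t ht => (hd1 t ht).deriv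
  have hφ3 : ContDiffOn ℝ 3 φ J :=
    hstep 2 le_rfl (hstep 1 (by norm_num) (hstep 0 (by norm_num)
      (contDiffOn_zero.2 hφd.continuousOn)))
  have hd2 : ∀ t ∈ J, HasDerivAt (deriv φ) (2 * y (φ t) ^ 3 * z (φ t)) t := by
    intro t ht
    have h1 : deriv φ =ᶠ[𝓝 t] fun τ => (y ∘ φ) τ ^ 2 := by
      filter_upwards [hJo.mem_nhds ht] with τ hτ using (hd1 τ hτ).deriv
    refine HasDerivAt.congr_of_eventuallyEq ?_ h1
    refine ((((hyz _ (hmU ht)).2.1.comp t (hd1 t ht))).fun_pow 2).congr_deriv ?_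
    simp only [Function.comp]
    ring
  have hd3 : ∀ t ∈ J, HasDerivAt (iteratedDeriv 2 φ)
      (6 * y (φ t) ^ 4 * z (φ t) ^ 2 + y (φ t) ^ 6 * K (φ t)) t := by
    intro t ht
    have h1 : iteratedDeriv 2 φ =ᶠ[𝓝 t] fun τ => 2 * (y ∘ φ) τ ^ 3 * (z ∘ φ) τ := by
      rw [iteratedDeriv_succ, iteratedDeriv_one]
      filter_upwards [hJo.mem_nhds ht] with τ hτ using (hd2 τ hτ).deriv
    refine HasDerivAt.congr_of_eventuallyEq ?_ h1
    refine (((((hyz _ (hmU ht)).2.1.comp t (hd1 t ht)).fun_pow 3).const_mul 2).fun_mul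
      ((hyz _ (hmU ht)).2.2.comp t (hd1 t ht))).congr_deriv ?_
    simp only [Function.comp]
    ring
  refine ⟨J, φ, hJo, by rw [hJ, Real.ball_eq_Ioo]; exact Set.ordConnected_Ioo, hφ3,
    fun t ht => hUI (hmU ht), ⟨t₀, Metric.mem_ball_self hδ, hφ0⟩, fun t ht => ?_⟩
  have hp := (hyz _ (hmU ht)).1
  have e2 : iteratedDeriv 2 φ t = 2 * y (φ t) ^ 3 * z (φ t) := by
    rw [iteratedDeriv_succ, iteratedDeriv_one, (hd2 t ht).deriv]
  have e3 : iteratedDeriv 3 φ t = 6 * y (φ t) ^ 4 * z (φ t) ^ 2 + y (φ t) ^ 6 * K (φ t) := by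
    rw [iteratedDeriv_succ (n := 2), (hd3 t ht).deriv]
  rw [(hd1 t ht).deriv, e2, e3]
  exact ⟨by positivity, by ring⟩

/-! ### World lines -/

theorem continuousOn_dot {f g : ℝ → E} {I : Set ℝ} (hf : ContinuousOn f I)
    (hg : ContinuousOn g I) : ContinuousOn (fun t => dot (f t) (g t)) I :=
  contDiff_dot.continuous.comp_continuousOn (hf.prodMk hg)

/-- Here `l`, `a`, `b` are again `φ'`, `φ''`, `φ'''`. Because of the weight of the power `4/3`, the
parametrization condition for `c ∘ φ` becomes a Schwarzian equation for `φ` whose potential depends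
on `c` alone. -/
theorem param_condition_reparam (A : ℝ) (w j : E) {u : E} (hu : 0 < dot u u) {l a b : ℝ}
    (hl : 0 < l)
    (h : l * b = 3 / 2 * a ^ 2 + l ^ 4 *
      ((3 / 2 * dot w w + 3 * (A * wedgeNrm w u ^ (4 / 3 : ℝ)) - dot j u) / dot u u)) :
    dot (l ^ 3 • j + (3 * l * a) • w + b • u) (l • u) =
      dot (l • u) (l • u) *
        paramFun (fun r => A * r ^ (4 / 3 : ℝ)) (l ^ 2 • w + a • u) (l • u) := by
  have e1 : wedgeNrm (l ^ 2 • w + a • u) (l • u) ^ (4 / 3 : ℝ) =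
      l ^ 4 * wedgeNrm w u ^ (4 / 3 : ℝ) := by
    have e2 : wedgeNrm (l ^ 2 • w + a • u) (l • u) = l ^ 3 * wedgeNrm w u := by
      rw [wedgeNrm, ← wedgeSq_sub_smul _ _ (a / l), ← wedgeNrm, smul_smul, div_mul_cancel₀ _ hl.ne',
        add_sub_cancel_right, wedgeNrm_smul_smul, abs_of_pos (by positivity)]
      ring
    rw [e2, Real.mul_rpow (by positivity) (wedgeNrm_nonneg _ _), ← Real.rpow_natCast_mul hl.le]
    norm_num
  have hu' := hu.ne'
  have hl' := hl.ne'
  simp only [paramFun, e1, dot_add_left, dot_add_right, dot_smul_left, dot_smul_right,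
    dot_comm u w]
  field_simp
  field_simp at h
  linear_combination h

variable {m A : ℝ} {s : E} {c : ℝ → E} {I : Set ℝ}

theorem IsWorldLine.pirani_and_isTopCurve (hs : dot s s < 0) (hc : IsTimelikeCurve c I)
    (h : IsWorldLine (topField m A s) s c I) : Pirani s c I ∧ IsTopCurve m s c I := by
  rw [Pirani, IsTopCurve, ← forall₂_and]
  intro t ht
  obtain ⟨J, φ, hJ, hJ', hφ, h0, hm, ⟨τ, hτ, rfl⟩, hP, hA⟩ := h t ht
  have hcφ := hc.comp hJ hJ' hφ h0 hm
  rw [topField_eq_solvedField, ← isTopCurve_and_hasParam_iff hs _ hcφ hP] at hA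
  constructor
  · have h1 := hP τ hτ
    rw [deriv_comp_reparam hc.isOpen hc.contDiffOn hJ hφ hm hτ, dot_smul_right] at h1
    exact (mul_eq_zero.1 h1).resolve_left (h0 τ hτ)
  · have h1 := hA.1 τ hτ
    rw [topVec_comp m hs hc hJ hφ h0 hm hτ] at h1
    exact (smul_eq_zero.1 h1).resolve_left (abs_ne_zero.2 (h0 τ hτ))

theorem isWorldLine_of_pirani_of_isTopCurve (hs : dot s s < 0) (hc : IsTimelikeCurve c I)
    (hP : Pirani s c I) (hT : IsTopCurve m s c I) : IsWorldLine (topField m A s) s c I := by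
  intro t ht
  have cu : ContinuousOn (deriv c) I := (contDiffOn_deriv_two hc.isOpen hc.contDiffOn).continuousOn
  have cw : ContinuousOn (iteratedDeriv 2 c) I :=
    (contDiffOn_iteratedDeriv_two hc.isOpen hc.contDiffOn).continuousOn
  have cj := continuousOn_iteratedDeriv_three hc.isOpen hc.contDiffOn
  have cN : ContinuousOn (fun t => wedgeNrm (iteratedDeriv 2 c t) (deriv c t)) I := by
    simp only [wedgeNrm, wedgeSq_eq]
    exact (((continuousOn_dot cw cw).mul (continuousOn_dot cu cu)).sub
      ((continuousOn_dot cw cu).pow 2)).abs.sqrt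
  obtain ⟨J, φ, hJ, hJ', hφ, hm, htφ, hφK⟩ := exists_reparam_schwarzian (hc.isOpen.mem_nhds ht)
    (K := fun t => (3 / 2 * dot (iteratedDeriv 2 c t) (iteratedDeriv 2 c t)
      + 3 * (A * wedgeNrm (iteratedDeriv 2 c t) (deriv c t) ^ (4 / 3 : ℝ))
      - dot (iteratedDeriv 3 c t) (deriv c t)) / dot (deriv c t) (deriv c t))
    ((((continuousOn_const.mul (continuousOn_dot cw cw)).add (continuousOn_const.mul
      (continuousOn_const.mul (cN.rpow_const fun _ _ => Or.inr (by norm_num))))).sub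
      (continuousOn_dot cj cu)).div (continuousOn_dot cu cu)
      fun t ht => (hc.timelike t ht).ne')
  have h0 : ∀ τ ∈ J, deriv φ τ ≠ 0 := fun τ hτ => (hφK τ hτ).1.ne'
  have hcφ := hc.comp hJ hJ' hφ h0 hm
  have hPφ : Pirani s (c ∘ φ) J := fun τ hτ => by
    rw [deriv_comp_reparam hc.isOpen hc.contDiffOn hJ hφ hm hτ, dot_smul_right, hP _ (hm hτ),
      mul_zero]
  refine ⟨J, φ, hJ, hJ', hφ, h0, hm, htφ, hPφ, ?_⟩
  rw [topField_eq_solvedField, ← isTopCurve_and_hasParam_iff hs _ hcφ hPφ]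
  refine ⟨fun τ hτ => ?_, fun τ hτ => ?_⟩
  · rw [topVec_comp m hs hc hJ hφ h0 hm hτ, hT _ (hm hτ), smul_zero]
  · rw [deriv_comp_reparam hc.isOpen hc.contDiffOn hJ hφ hm hτ,
      iteratedDeriv_two_comp_reparam hc.isOpen hc.contDiffOn hJ hφ hm hτ,
      iteratedDeriv_three_comp_reparam hc.isOpen hc.contDiffOn hJ hφ hm hτ]
    exact param_condition_reparam A _ _ (hc.timelike _ (hm hτ)) (hφK τ hτ).1 (hφK τ hτ).2

theorem isWorldLine_iff (hs : dot s s < 0) (hc : IsTimelikeCurve c I) :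
    IsWorldLine (topField m A s) s c I ↔ Pirani s c I ∧ IsTopCurve m s c I :=
  ⟨fun h => h.pirani_and_isTopCurve hs hc,
    fun h => isWorldLine_of_pirani_of_isTopCurve hs hc h.1 h.2⟩

/-- Otherwise all four basis vectors would lie in the span of `u` and `s`, of dimension at most two.
-/
theorem exists_regularAt (hs : dot s s < 0) (hc : IsTimelikeCurve c I)
    (e : Module.Basis (Fin 4) ℝ E) {t : ℝ} (ht : t ∈ I) : ∃ α, RegularAt s (e α) c t := by
  by_contra! hno
  have hu := hc.timelike t ht
  have hmem : ∀ α, e α ∈ Submodule.span ℝ (Set.range ![deriv c t, s]) := by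
    intro α
    obtain ⟨g, hg, i, hi⟩ := Fintype.not_linearIndependent_iff.1 (hno α)
    simp only [Fin.sum_univ_three, Matrix.cons_val] at hg
    have hus : deriv c t ∈ Submodule.span ℝ (Set.range ![deriv c t, s]) :=
      Submodule.subset_span ⟨0, rfl⟩
    have hss : s ∈ Submodule.span ℝ (Set.range ![deriv c t, s]) :=
      Submodule.subset_span ⟨1, rfl⟩
    have h2 : g 2 ≠ 0 := by
      intro h2
      rw [h2, zero_smul, add_zero] at hg
      -- A timelike and a spacelike vector are independent: the two sides have opposite signs.
      have hsq : g 0 ^ 2 * dot (deriv c t) (deriv c t) = g 1 ^ 2 * dot s s := by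
        have h3 := congrArg (fun v => dot v v) (eq_neg_of_add_eq_zero_left hg)
        simp only [dot_neg_left, dot_neg_right, dot_smul_left, dot_smul_right] at h3
        linarith
      have h4 : g 1 = 0 := by
        by_contra h4
        nlinarith [mul_neg_of_pos_of_neg (sq_pos_of_ne_zero h4) hs, sq_nonneg (g 0)]
      have h5 : g 0 = 0 := by
        by_contra h5
        rw [h4] at hsq
        nlinarith [mul_pos (sq_pos_of_ne_zero h5) hu]
      fin_cases i <;> simp_all
    have h3 : e α = (-(g 0 / g 2)) • deriv c t + (-(g 1 / g 2)) • s := by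
      have h4 : g 2 • e α = -(g 0 • deriv c t + g 1 • s) := eq_neg_of_add_eq_zero_right hg
      rw [← inv_smul_smul₀ h2 (e α), h4]
      module
    rw [h3]
    exact add_mem (Submodule.smul_mem _ _ hus) (Submodule.smul_mem _ _ hss)
  have htop : (⊤ : Submodule ℝ E) ≤ Submodule.span ℝ (Set.range ![deriv c t, s]) := by
    rw [← e.span_eq, Submodule.span_le]
    rintro _ ⟨α, rfl⟩
    exact hmem α
  have h1 := Submodule.finrank_mono htop
  have h2 := finrank_range_le_card (R := ℝ) ![deriv c t, s]
  rw [Set.finrank] at h2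
  simp at h1 h2
  omega

theorem forall_eulerLagrange_eq_zero_iff (hs : dot s s < 0) (hc : IsTimelikeCurve c I) {e : E}
    {t : ℝ} (ht : t ∈ I) (he : RegularAt s e c t) :
    (∀ h, eulerLagrange (lagrangian m s e) c t h = 0) ↔
      topVec m s (deriv c t) (iteratedDeriv 2 c t) (iteratedDeriv 3 c t) = 0 := by
  simp only [eulerLagrange_lagrangian m hs hc ht he]
  exact ⟨eq_zero_of_forall_dot, fun h v => by rw [h, dot_zero_left]⟩

end RelTop

/-! ### Assembly of the statements -/

theorem mainTheorem2 (m : ℝ) (s : RelTop.E) (hs : RelTop.dot s s < 0) :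
    -- every Lagrange function of the family produces the third-order equation
    (∀ (e : Module.Basis (Fin 4) ℝ RelTop.E) (α : Fin 4) (c : ℝ → RelTop.E) (I : Set ℝ),
      RelTop.IsTimelikeCurve c I → ∀ t ∈ I, RelTop.RegularAt s (e α) c t → ∀ h : RelTop.E,
        RelTop.eulerLagrange (RelTop.lagrangian m s (e α)) c t h =
          RelTop.dot (RelTop.topVec m s (deriv c t) (iteratedDeriv 2 c t) (iteratedDeriv 3 c t)) h) ∧
    -- with the constraint, it is the equation of the relativistic top
    (∀ (c : ℝ → RelTop.E) (I : Set ℝ), RelTop.IsTimelikeCurve c I → RelTop.Pirani s c I →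
      (RelTop.IsTopCurve m s c I ↔ RelTop.IsMathissonCurve m s c I)) ∧
    -- with the constraint and a parametrization condition, it can be solved for `ü`
    (∀ (Ψ : RelTop.E → RelTop.E → ℝ) (c : ℝ → RelTop.E) (I : Set ℝ),
      RelTop.IsTimelikeCurve c I → RelTop.Pirani s c I →
      ((RelTop.IsTopCurve m s c I ∧ RelTop.HasParam Ψ c I) ↔
        RelTop.IsAutoparallel (RelTop.solvedField m s Ψ) c I)) ∧
    -- the commutation relations with `κ = μ = 0` single out the one-parameter family of connections
    (∀ f : ℝ → ℝ,
      RelTop.IsAutoparallelField (RelTop.solvedField m s (RelTop.paramFun f)) 0 0 ↔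
        ∃ A : ℝ, ∀ r : ℝ, 0 ≤ r → f r = A * r ^ (4 / 3 : ℝ)) ∧
    ∀ A : ℝ,
      -- the explicit equation is the equation of autoparallel curves of a second-order connection
      RelTop.IsAutoparallelField (RelTop.topField m A s) 0 0 ∧
      -- its solutions are the motions of the top in the parametrization fixed by `A`
      (∀ (c : ℝ → RelTop.E) (I : Set ℝ), RelTop.IsTimelikeCurve c I → RelTop.Pirani s c I →
        ((RelTop.IsTopCurve m s c I ∧
            RelTop.HasParam (RelTop.paramFun fun r => A * r ^ (4 / 3 : ℝ)) c I) ↔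
          RelTop.IsAutoparallel (RelTop.topField m A s) c I)) ∧
      -- world lines are the extremals of any one of the Lagrange functions with the constraint
      (∀ (e : Module.Basis (Fin 4) ℝ RelTop.E) (α : Fin 4) (c : ℝ → RelTop.E) (I : Set ℝ),
        RelTop.IsTimelikeCurve c I → (∀ t ∈ I, RelTop.RegularAt s (e α) c t) →
        (RelTop.IsWorldLine (RelTop.topField m A s) s c I ↔
          RelTop.Pirani s c I ∧
            ∀ t ∈ I, ∀ h : RelTop.E,
              RelTop.eulerLagrange (RelTop.lagrangian m s (e α)) c t h = 0)) ∧
      -- the same without a single Lagrange function being regular along the whole curve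
      (∀ (e : Module.Basis (Fin 4) ℝ RelTop.E) (c : ℝ → RelTop.E) (I : Set ℝ),
        RelTop.IsTimelikeCurve c I →
        (RelTop.IsWorldLine (RelTop.topField m A s) s c I ↔
          RelTop.Pirani s c I ∧
            ∀ t ∈ I, ∃ α : Fin 4, RelTop.RegularAt s (e α) c t ∧ ∀ h : RelTop.E,
              RelTop.eulerLagrange (RelTop.lagrangian m s (e α)) c t h = 0)) := by
  refine ⟨fun e α c I hc t ht he h => RelTop.eulerLagrange_lagrangian m hs hc ht he h,
    fun c I hc hP => RelTop.isTopCurve_iff_isMathissonCurve hs hc hP,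
    fun Ψ c I hc hP => RelTop.isTopCurve_and_hasParam_iff hs Ψ hc hP,
    fun f => RelTop.isAutoparallelField_solvedField_iff m hs f,
    fun A => ⟨RelTop.isAutoparallelField_topField m A hs, fun c I hc hP => ?_,
      fun e α c I hc he => ?_, fun e c I hc => ?_⟩⟩
  · rw [RelTop.topField_eq_solvedField]
    exact RelTop.isTopCurve_and_hasParam_iff hs _ hc hP
  · rw [RelTop.isWorldLine_iff hs hc]
    exact and_congr_right fun _ => forall₂_congr fun t ht =>
      (RelTop.forall_eulerLagrange_eq_zero_iff hs hc ht (he t ht)).symm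
  · rw [RelTop.isWorldLine_iff hs hc]
    refine and_congr_right fun _ => forall₂_congr fun t ht => ⟨fun h => ?_, ?_⟩
    · obtain ⟨α, hα⟩ := RelTop.exists_regularAt hs hc e ht
      exact ⟨α, hα, (RelTop.forall_eulerLagrange_eq_zero_iff hs hc ht hα).2 h⟩
    · rintro ⟨α, hα, h⟩
      exact (RelTop.forall_eulerLagrange_eq_zero_iff hs hc ht hα).1 h
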